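/- All structures considered are structures in the language $\{<\}$ (with equality) whose domain is a subset of $\mathbb{N}$. A basic sentence is an atomic sentence $a=b$ or $a<b$ with $a,b\in\mathbb{N}$, or the negation of one. The atomic diagram $D(\mathcal{A})$ of a structure $\mathcal{A}$ is the set of all basic sentences with constants from the domain of $\mathcal{A}$ that are true in $\mathcal{A}$. An enumeration operator is a computably enumerable set $\Gamma$ of pairs $(\alpha,\varphi)$, where $\alpha$ is a finite set of basic sentences and $\varphi$ is a basic sentence; put $\Gamma(\mathcal{A})=\{\varphi : (\alpha,\varphi)\in\Gamma \text{ for some } \alpha\subseteq D(\mathcal{A})\}$. For classes $\mathcal{K}_0,\mathcal{K}_1$ of such structures, write $\mathcal{K}_0\leq_c\mathcal{K}_1$ ($\mathcal{K}_0$ is computably embeddable into $\mathcal{K}_1$) if there is an enumeration operator $\Gamma$ such that (1) for every $\mathcal{A}\in\mathcal{K}_0$, $\Gamma(\mathcal{A})$ is the atomic diagram of a structure from $\mathcal{K}_1$, and (2) for all $\mathcal{A},\mathcal{B}\in\mathcal{K}_0$, $\mathcal{A}\cong\mathcal{B}$ if and only if the structures with atomic diagrams $\Gamma(\mathcal{A})$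 and $\Gamma(\mathcal{B})$ are isomorphic. For a positive integer $k$ let $\omega\cdot k$ be the sum of $k$ copies of the order type $\omega$ of $\mathbb{N}$, and $\omega^\star\cdot k$ the sum of $k$ copies of the reverse order type $\omega^\star$. Let $\{\omega\cdot k,\omega^\star\cdot k\}$ denote the class of all linear orders with domain a subset of $\mathbb{N}$ that are isomorphic to $\omega\cdot k$ or to $\omega^\star\cdot k$. **Theorem.** For any two non-zero natural numbers $k$ and $t$, $$k \mid t \iff \{\omega\cdot k,\omega^\star\cdot k\}\leq_c\{\omega\cdot t,\omega^\star\cdot t\}.$$ -/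

import Mathlib

namespace LinOrdEmb

/-- Basic sentences (atomic sentences and negated atomic sentences) of the language `{<}` of linear
orders expanded by constants for the natural numbers. -/
inductive BasicSentence : Type
  | eq (a b : ℕ) : BasicSentence
  | ne (a b : ℕ) : BasicSentence
  | lt (a b : ℕ) : BasicSentence
  | nlt (a b : ℕ) : BasicSentence
  deriving DecidableEq

/-- The Gödel numbering of basic sentences: four kinds of sentences, each given by two numbers. -/
def BasicSentence.equivSum :
    BasicSentence ≃ ((ℕ × ℕ) ⊕ (ℕ × ℕ)) ⊕ ((ℕ × ℕ) ⊕ (ℕ × ℕ)) where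
  toFun
    | .eq a b => .inl (.inl (a, b))
    | .ne a b => .inl (.inr (a, b))
    | .lt a b => .inr (.inl (a, b))
    | .nlt a b => .inr (.inr (a, b))
  invFun
    | .inl (.inl p) => .eq p.1 p.2
    | .inl (.inr p) => .ne p.1 p.2
    | .inr (.inl p) => .lt p.1 p.2
    | .inr (.inr p) => .nlt p.1 p.2
  left_inv := by rintro (_ | _ | _ | _) <;> rfl
  right_inv := by rintro ((_ | _) | (_ | _)) <;> rfl

instance : Primcodable BasicSentence :=
  Primcodable.ofEquiv _ BasicSentence.equivSum

/-- A structure in the language `{<}` whose domain is a set of natural numbers. -/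
structure Str where
  dom : Set ℕ
  lt : dom → dom → Prop

namespace Str

/-- Truth of a basic sentence in a structure; in particular all constants that occur in the
sentence have to belong to the domain. -/
def Holds (A : Str) : BasicSentence → Prop
  | .eq a b => a ∈ A.dom ∧ b ∈ A.dom ∧ a = b
  | .ne a b => a ∈ A.dom ∧ b ∈ A.dom ∧ a ≠ b
  | .lt a b => ∃ (ha : a ∈ A.dom) (hb : b ∈ A.dom), A.lt ⟨a, ha⟩ ⟨b, hb⟩
  | .nlt a b => ∃ (ha : a ∈ A.dom) (hb : b ∈ A.dom), ¬ A.lt ⟨a, ha⟩ ⟨b, hb⟩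

/-- The atomic diagram. -/
def diagram (A : Str) : Set BasicSentence := {φ | A.Holds φ}

/-- Isomorphism of structures. -/
def Iso (A B : Str) : Prop := Nonempty (A.lt ≃r B.lt)

end Str

/-- The result of applying `Γ`, a set of pairs `(α, φ)` with `α` a finite set of basic sentences and
`φ` a basic sentence, to a set `S` of basic sentences. -/
def applyOp (Γ : Set (Finset BasicSentence × BasicSentence)) (S : Set BasicSentence) :
    Set BasicSentence :=
  {φ | ∃ α : Finset BasicSentence, (α, φ) ∈ Γ ∧ ∀ ψ ∈ α, ψ ∈ S}

/-- `Γ` is an enumeration operator: it is computably enumerable, finite sets of basic sentences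
being presented by lists of their elements. -/
def IsEnumerationOperator (Γ : Set (Finset BasicSentence × BasicSentence)) : Prop :=
  REPred fun p : List BasicSentence × BasicSentence => (p.1.toFinset, p.2) ∈ Γ

/-- `Γ` is a computable embedding of the class `K₀` into the class `K₁`. -/
structure IsComputableEmbedding (Γ : Set (Finset BasicSentence × BasicSentence))
    (K₀ K₁ : Set Str) : Prop where
  enum : IsEnumerationOperator Γ
  maps : ∀ A ∈ K₀, ∃ A' ∈ K₁, applyOp Γ A.diagram = A'.diagram
  iso_iff : ∀ A ∈ K₀, ∀ B ∈ K₀, ∀ A' B' : Str,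
    applyOp Γ A.diagram = A'.diagram → applyOp Γ B.diagram = B'.diagram →
      (A.Iso B ↔ A'.Iso B')

/-- `K₀ ≤_c K₁`. -/
def ComputablyEmbeddable (K₀ K₁ : Set Str) : Prop :=
  ∃ Γ, IsComputableEmbedding Γ K₀ K₁

/-- All copies, with domain a set of natural numbers, of the linear order `X`. -/
def copies (X : Type) [LT X] : Set Str :=
  {A | Nonempty (A.lt ≃r ((· < ·) : X → X → Prop))}

/-- The class `{ω · k, ω* · k}`: all copies of the sum of `k` copies of `ω` and all copies of the
sum of `k` copies of `ω*`. In the lexicographic products the coordinate in `Fin k` is the more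
significant one. -/
def omegaPair (k : ℕ) : Set Str :=
  copies (Fin k ×ₗ ℕ) ∪ copies (Fin k ×ₗ ℕᵒᵈ)

end LinOrdEmb

/-!
If `k ∣ t`, then the operator that replaces a structure by the sum of `t / k` copies of itself is a
computable embedding (`computablyEmbeddable_mul`).

For the converse, no use is made of computability, only of the fact that an enumeration operator `Γ`
is monotone and uses finitely many sentences at a time. After reversing the images if necessary, `Γ`
maps `ω · k` to `ω · t` and `ω* · k` to `ω* · t`. Finite suborders are nodup lists `L` of names, and
`Forces Γ k L φ` says that `φ` is in the image of all copies extending `L`. Every finite order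
extends to a copy of `ω · k` by fresh names on top, and such a copy can be amalgamated over `L` with
any other extension of `L`; hence a finite order already determines how the elements it puts into
the image are compared (`PreservesOrientation.below_total`).

Take the standard copy of `ω · k` and cut its blocks into finite pieces, the `i`-th piece consisting
of one part from each block and putting an element `x i a` into the `a`-th block of the image, for
every `a < t` (`PreservesOrientation.exists_pieces`). By Ramsey's theorem one may assume that, for
`i < j`, it depends only on `a`, `b` and `p` whether `x i a < x j b` when the `j`-th piece is inserted
after the first `p` parts of the `i`-th. Placing whole pieces one after the other, in order type
`ω` or `ω*`, yields a total preorder `K` on the indices `a`: for `a` and `b` in different classes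
the elements `x i a` and `x j b` are always compared in the same way, and within a class they follow
the order of the pieces. If there are `m` classes, then

* distributing the pieces over the `k` blocks of a new copy of `ω · k` embeds `ω · k · m` into
  `ω · t`, so that `k * m ≤ t` (`Homogeneous.card_mul_le`);
* each `a` has a pivot, namely the part of a piece at which the result of inserting another piece
  changes, and `a` is determined by its class and its pivot, so that `t ≤ k * m`
  (`PreservesOrientation.dvd`).
-/

namespace LinOrdEmb

/-! ### Structures, finite suborders and copies of `ω · k` -/

namespace Str

/-- The order of a structure, as a relation on names. -/
def Lt (A : Str) (a b : ℕ) : Prop := A.Holds (.lt a b)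

/-- The order of `A` is a strict linear order. -/
structure IsLinear (A : Str) : Prop where
  irrefl : ∀ a, ¬ A.Lt a a
  trans : ∀ a b c, A.Lt a b → A.Lt b c → A.Lt a c
  total : ∀ a ∈ A.dom, ∀ b ∈ A.dom, a ≠ b → A.Lt a b ∨ A.Lt b a

/-- The list `L` enumerates a finite suborder of `A` in increasing order. -/
def HasSub (A : Str) (L : List ℕ) : Prop := (∀ a ∈ L, a ∈ A.dom) ∧ L.Pairwise A.Lt

/-- The reversed structure. -/
def rev (A : Str) : Str := ⟨A.dom, fun a b => A.lt b a⟩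

/-- The structure on the names in `D`, ordered lexicographically by the pair `(b v, p v)`. -/
def keyStr (D : Set ℕ) (b p : ℕ → ℕ) : Str :=
  ⟨D, fun u v => b u < b v ∨ b u = b v ∧ p u < p v⟩

variable {A B : Str}

lemma Lt.right {a b : ℕ} (h : A.Lt a b) : b ∈ A.dom := h.2.1

lemma eq_mem_diagram {a : ℕ} : BasicSentence.eq a a ∈ A.diagram ↔ a ∈ A.dom := by
  simp [diagram, Holds]

lemma lt_mem_diagram {a b : ℕ} : BasicSentence.lt a b ∈ A.diagram ↔ A.Lt a b := Iff.rfl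

lemma keyStr_lt {D : Set ℕ} {b p : ℕ → ℕ} {u v : ℕ} :
    (keyStr D b p).Lt u v ↔ u ∈ D ∧ v ∈ D ∧ (b u < b v ∨ b u = b v ∧ p u < p v) := by
  simp only [Lt, Holds, keyStr, exists_prop]

lemma rev_lt {u v : ℕ} : A.rev.Lt u v ↔ A.Lt v u :=
  ⟨fun ⟨h1, h2, h⟩ => ⟨h2, h1, h⟩, fun ⟨h1, h2, h⟩ => ⟨h2, h1, h⟩⟩

lemma HasSub.sublist {L M : List ℕ} (h : A.HasSub M) (hs : L.Sublist M) : A.HasSub L :=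
  ⟨fun a ha => h.1 a (hs.subset ha), h.2.sublist hs⟩

lemma HasSub.rev {L : List ℕ} (h : A.HasSub L) : A.rev.HasSub L.reverse :=
  ⟨fun a ha => h.1 a (List.mem_reverse.1 ha),
    List.pairwise_reverse.2 (h.2.imp fun h => rev_lt.2 h)⟩

lemma IsLinear.nodup (hA : A.IsLinear) {L : List ℕ} (h : A.HasSub L) : L.Nodup :=
  h.2.imp fun {a b} hab => by rintro rfl; exact hA.irrefl _ hab

lemma IsLinear.asymm (hA : A.IsLinear) {a b : ℕ} (h : A.Lt a b) : ¬ A.Lt b a :=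
  fun h' => hA.irrefl _ (hA.trans _ _ _ h h')

lemma IsLinear.sublist_of_subset (hA : A.IsLinear) {L M : List ℕ} (hL : A.HasSub L)
    (hM : A.HasSub M) (h : L ⊆ M) : L.Sublist M := by
  let r : ℕ → ℕ → Prop := A.Lt
  have : Std.Antisymm r := ⟨fun a b h h' => (hA.asymm h h').elim⟩
  exact List.sublist_of_subperm_of_pairwise (r := r)
    (List.subperm_of_subset (hA.nodup hL) h) hL.2 hM.2

lemma IsLinear.exists_hasSub (hA : A.IsLinear) (s : Finset ℕ) (hs : ∀ a ∈ s, a ∈ A.dom) :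
    ∃ L, A.HasSub L ∧ ∀ a, a ∈ L ↔ a ∈ s := by
  classical
  induction s using Finset.induction_on with
  | empty => exact ⟨[], ⟨by simp, List.Pairwise.nil⟩, by simp⟩
  | insert a s ha ih =>
    obtain ⟨L, hL, hm⟩ := ih fun b hb => hs b (Finset.mem_insert_of_mem hb)
    have had := hs a (Finset.mem_insert_self _ _)
    refine ⟨L.filter (fun b => A.Lt b a) ++ a :: L.filter (fun b => A.Lt a b), ⟨?_, ?_⟩, ?_⟩
    · intro b hb
      simp only [List.mem_append, List.mem_filter, List.mem_cons] at hb
      rcases hb with hb | rfl | hb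
      exacts [hL.1 _ hb.1, had, hL.1 _ hb.1]
    · rw [List.pairwise_append]
      refine ⟨hL.2.filter _, List.pairwise_cons.2 ⟨?_, hL.2.filter _⟩, ?_⟩
      · intro b hb
        simpa using (List.mem_filter.1 hb).2
      · intro b hb c hc
        have hb : A.Lt b a := by simpa using (List.mem_filter.1 hb).2
        rcases List.mem_cons.1 hc with rfl | hc
        · exact hb
        · exact hA.trans _ _ _ hb (by simpa using (List.mem_filter.1 hc).2)
    · intro b
      simp only [List.mem_append, List.mem_filter, List.mem_cons, Finset.mem_insert, hm,
        decide_eq_true_eq]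
      constructor
      · rintro (h | h | h) <;> simp_all
      · rintro (h | h)
        · simp_all
        · have := hA.total b (hs b (Finset.mem_insert_of_mem h)) a had (by rintro rfl; exact ha h)
          tauto

end Str

/-- The constants of a basic sentence. -/
def BasicSentence.consts : BasicSentence → Finset ℕ
  | .eq a b => {a, b}
  | .ne a b => {a, b}
  | .lt a b => {a, b}
  | .nlt a b => {a, b}

namespace Str

variable {A B : Str}

lemma consts_subset_dom {ψ : BasicSentence} (h : ψ ∈ A.diagram) : ∀ a ∈ ψ.consts, a ∈ A.dom := by
  rcases ψ with ⟨a, b⟩ | ⟨a, b⟩ | ⟨a, b⟩ | ⟨a, b⟩ <;> obtain ⟨h1, h2, -⟩ := h <;>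
    simp [BasicSentence.consts, h1, h2]

/-- Basic sentences about a common finite suborder are absolute. -/
lemma mem_diagram_of_hasSub (hA : A.IsLinear) (hB : B.IsLinear) {L : List ℕ} (hLA : A.HasSub L)
    (hLB : B.HasSub L) {ψ : BasicSentence} (hc : ∀ a ∈ ψ.consts, a ∈ L) (h : ψ ∈ A.diagram) :
    ψ ∈ B.diagram := by
  have key : ∀ a ∈ L, ∀ b ∈ L, a ≠ b → (A.Lt a b ∧ B.Lt a b) ∨ (A.Lt b a ∧ B.Lt b a) := by
    intro a ha b hb hab
    have h2 : L.Pairwise fun a b => (A.Lt a b ∧ B.Lt a b) ∨ (A.Lt b a ∧ B.Lt b a) :=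
      (hLA.2.and hLB.2).imp fun h => Or.inl h
    have : Std.Symm fun a b => (A.Lt a b ∧ B.Lt a b) ∨ (A.Lt b a ∧ B.Lt b a) :=
      ⟨fun x y h => h.symm⟩
    exact h2.forall ha hb hab
  rcases ψ with ⟨a, b⟩ | ⟨a, b⟩ | ⟨a, b⟩ | ⟨a, b⟩ <;>
    have ha := hc a (by simp [BasicSentence.consts]) <;>
    have hb := hc b (by simp [BasicSentence.consts])
  · exact ⟨hLB.1 _ ha, hLB.1 _ hb, h.2.2⟩
  · exact ⟨hLB.1 _ ha, hLB.1 _ hb, h.2.2⟩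
  · have h : A.Lt a b := h
    rcases key a ha b hb (by rintro rfl; exact hA.irrefl _ h) with h' | h'
    · exact h'.2
    · exact (hA.asymm h h'.1).elim
  · refine ⟨hLB.1 _ ha, hLB.1 _ hb, fun hlt => ?_⟩
    have hlt : B.Lt a b := ⟨_, _, hlt⟩
    obtain ⟨h1, h2, h⟩ := h
    rcases key a ha b hb (by rintro rfl; exact hB.irrefl _ hlt) with h' | h'
    · exact h h'.1.2.2
    · exact hB.asymm hlt h'.2

end Str

lemma isLinear_of_copies {X : Type} [LinearOrder X] {A : Str} (h : A ∈ copies X) :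
    A.IsLinear := by
  obtain ⟨e⟩ := h
  refine ⟨?_, ?_, ?_⟩
  · rintro a ⟨h1, h2, h⟩
    exact lt_irrefl _ (e.map_rel_iff.2 h)
  · rintro a b c ⟨h1, h2, h⟩ ⟨h3, h4, h'⟩
    exact ⟨h1, h4, e.map_rel_iff.1 ((e.map_rel_iff.2 h).trans (e.map_rel_iff.2 h'))⟩
  · intro a ha b hb hab
    have : e ⟨a, ha⟩ ≠ e ⟨b, hb⟩ := fun h => hab (by simpa using e.injective h)
    rcases lt_or_gt_of_ne this with h | h
    · exact Or.inl ⟨ha, hb, e.map_rel_iff.1 h⟩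
    · exact Or.inr ⟨hb, ha, e.map_rel_iff.1 h⟩

lemma isLinear_of_omegaPair {k : ℕ} {A : Str} (h : A ∈ omegaPair k) : A.IsLinear :=
  h.elim isLinear_of_copies isLinear_of_copies

lemma rev_mem_copies_dual {k : ℕ} {A : Str} (h : A ∈ copies (Fin k ×ₗ ℕ)) :
    A.rev ∈ copies (Fin k ×ₗ ℕᵒᵈ) := by
  obtain ⟨e⟩ := h
  let f : (Fin k ×ₗ ℕ) ≃ (Fin k ×ₗ ℕᵒᵈ) :=
    (ofLex.trans (Equiv.prodCongr Fin.revPerm OrderDual.toDual)).trans toLex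
  refine ⟨⟨e.toEquiv.trans f, ?_⟩⟩
  intro (a : A.dom) (b : A.dom)
  change f (e a) < f (e b) ↔ A.lt b a
  rw [← e.map_rel_iff]
  simp only [Prod.Lex.lt_iff, f]
  simp [eq_comm]

lemma rev_mem_copies {k : ℕ} {A : Str} (h : A ∈ copies (Fin k ×ₗ ℕᵒᵈ)) :
    A.rev ∈ copies (Fin k ×ₗ ℕ) := by
  obtain ⟨e⟩ := h
  let f : (Fin k ×ₗ ℕᵒᵈ) ≃ (Fin k ×ₗ ℕ) :=
    (ofLex.trans (Equiv.prodCongr Fin.revPerm OrderDual.ofDual)).trans toLex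
  refine ⟨⟨e.toEquiv.trans f, ?_⟩⟩
  intro (a : A.dom) (b : A.dom)
  change f (e a) < f (e b) ↔ A.lt b a
  rw [← e.map_rel_iff]
  simp only [Prod.Lex.lt_iff, f]
  simp [eq_comm]

/-- A lexicographic key with values in `k × ℕ`, all of whose fibres over `k` are infinite, gives a
copy of `ω · k`. -/
lemma keyStr_mem_copies {k : ℕ} {D : Set ℕ} {b p : ℕ → ℕ} (hb : ∀ v ∈ D, b v < k)
    (hinj : ∀ u ∈ D, ∀ v ∈ D, b u = b v → p u = p v → u = v)
    (hinf : ∀ r < k, ({v | v ∈ D ∧ b v = r} : Set ℕ).Infinite) :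
    Str.keyStr D b p ∈ copies (Fin k ×ₗ ℕ) := by
  classical
  let P : ℕ → ℕ → Prop := fun r n => ∃ v ∈ D, b v = r ∧ p v = n
  have hP : ∀ r < k, ({n | P r n}).Infinite := by
    intro r hr
    have : {n | P r n} = p '' {v | v ∈ D ∧ b v = r} := by
      ext n; simp [P, and_assoc]
    rw [this]
    exact (hinf r hr).image fun u hu v hv h => hinj u hu.1 v hv.1 (hu.2.trans hv.2.symm) h
  have hch : ∀ x : Fin k ×ₗ ℕ, ∃ v ∈ D, b v = (ofLex x).1 ∧
      p v = Nat.nth (P (ofLex x).1) (ofLex x).2 :=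
    fun x => Nat.nth_mem_of_infinite (hP _ (ofLex x).1.2) _
  choose f hfD hfb hfp using hch
  have hmono : ∀ x y : Fin k ×ₗ ℕ, x < y ↔
      (Str.keyStr D b p).lt ⟨f x, hfD x⟩ ⟨f y, hfD y⟩ := by
    intro x y
    change _ ↔ (b (f x) < b (f y) ∨ b (f x) = b (f y) ∧ p (f x) < p (f y))
    rw [Prod.Lex.lt_iff, hfb, hfb, hfp, hfp]
    simp only [Fin.val_fin_lt, Fin.val_inj]
    refine or_congr Iff.rfl (and_congr_right fun h => ?_)
    rw [h, (Nat.nth_strictMono (hP _ (ofLex y).1.2)).lt_iff_lt]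
  have hinjf : Function.Injective fun x => (⟨f x, hfD x⟩ : D) := by
    intro x y h
    have h : f x = f y := by simpa using h
    by_contra hne
    rcases lt_or_gt_of_ne hne with h' | h' <;>
    · have := (hmono _ _).1 h'
      rcases this with h1 | ⟨-, h1⟩ <;> simp [h] at h1
  have hsurj : Function.Surjective fun x => (⟨f x, hfD x⟩ : D) := by
    rintro ⟨v, hv⟩
    have hmem : p v ∈ Set.range (Nat.nth (P (b v))) := by
      rw [Nat.range_nth_of_infinite (hP _ (hb v hv))]
      exact ⟨v, hv, rfl, rfl⟩
    obtain ⟨n, hn⟩ := hmem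
    refine ⟨toLex (⟨b v, hb v hv⟩, n), Subtype.ext ?_⟩
    exact hinj _ (hfD _) _ hv (hfb _) ((hfp _).trans hn)
  exact ⟨(RelIso.mk (Equiv.ofBijective _ ⟨hinjf, hsurj⟩) fun {x y} => (hmono x y).symm).symm⟩

/-! ### Explicit copies of `ω · k` and `ω* · k` -/

/-- The copy of `ω · k` that starts with the finite order `L` and goes on with the names `v ≥ n`,
distributed over the `k` blocks according to their residues modulo `k`. -/
def extStr (k : ℕ) (L : List ℕ) (n : ℕ) : Str :=
  Str.keyStr {v | v ∈ L ∨ n ≤ v} (fun v => if v ∈ L then 0 else v % k)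
    (fun v => if v ∈ L then L.idxOf v else L.length + v)

lemma infinite_residue {k r : ℕ} (hr : r < k) (n : ℕ) :
    ({v | n ≤ v ∧ v % k = r} : Set ℕ).Infinite := by
  rw [Set.infinite_iff_exists_gt]
  intro a
  refine ⟨r + k * (n + a + 1), ⟨?_, ?_⟩, ?_⟩
  · nlinarith [Nat.zero_le r, Nat.pos_of_ne_zero (by omega : k ≠ 0)]
  · rw [Nat.add_mul_mod_self_left, Nat.mod_eq_of_lt hr]
  · nlinarith [Nat.zero_le r, Nat.pos_of_ne_zero (by omega : k ≠ 0)]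

lemma extStr_mem {k : ℕ} (hk : k ≠ 0) (L : List ℕ) (n : ℕ) :
    extStr k L n ∈ copies (Fin k ×ₗ ℕ) := by
  have hk' := Nat.pos_of_ne_zero hk
  refine keyStr_mem_copies ?_ ?_ ?_
  · intro v _
    split_ifs
    exacts [hk', Nat.mod_lt _ hk']
  · intro u _ v _ _ h
    split_ifs at h with hu hv hv
    · exact (List.idxOf_inj hu).1 h
    · have := List.idxOf_lt_length_iff.2 hu; omega
    · have := List.idxOf_lt_length_iff.2 hv; omega
    · omega
  · intro r hr
    refine ((infinite_residue hr n).sdiff L.toFinset.finite_toSet).mono ?_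
    rintro v ⟨⟨h1, h2⟩, h3⟩
    have h3 : v ∉ L := by simpa using h3
    exact ⟨Or.inr h1, by simp [h3, h2]⟩

lemma extStr_hasSub {k : ℕ} {L : List ℕ} (hL : L.Nodup) (n : ℕ) : (extStr k L n).HasSub L := by
  refine ⟨fun a ha => Or.inl ha, ?_⟩
  rw [List.pairwise_iff_getElem]
  intro i j hi hj hij
  rw [extStr, Str.keyStr_lt]
  refine ⟨Or.inl (List.getElem_mem _), Or.inl (List.getElem_mem _), Or.inr ?_⟩
  simp [List.getElem_mem, hL.idxOf_getElem, hij]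

lemma extStr_hasSub_append {k : ℕ} {L P : List ℕ} {n : ℕ} (hL : L.Nodup)
    (hP : (extStr k L n).HasSub P) (hd : ∀ a ∈ P, a ∉ L) : (extStr k L n).HasSub (L ++ P) := by
  have hL' := extStr_hasSub (k := k) hL n
  refine ⟨fun a ha => (List.mem_append.1 ha).elim (hL'.1 a) (hP.1 a),
    List.pairwise_append.2 ⟨hL'.2, hP.2, ?_⟩⟩
  intro a ha b hb
  rw [extStr, Str.keyStr_lt]
  refine ⟨hL'.1 a ha, hP.1 b hb, ?_⟩
  have := List.idxOf_lt_length_iff.2 ha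
  simp only [ha, hd b hb, if_true, if_false]
  omega

/-- Disjoint finite orders can be put together to a copy of `ω · k`, the `i`-th of them being placed
as a whole in the block given by the residue of `i`. -/
lemma exists_copies_of_lists {k : ℕ} (hk : k ≠ 0) {F : ℕ → List ℕ} (hnd : ∀ i, (F i).Nodup)
    (hne : ∀ i, F i ≠ []) (hdisj : ∀ i j, i ≠ j → (F i).Disjoint (F j)) :
    ∃ A ∈ copies (Fin k ×ₗ ℕ), ∀ i j, (i % k < j % k ∨ i % k = j % k ∧ i < j) →
      A.HasSub (F i ++ F j) := by
  classical
  have hk' := Nat.pos_of_ne_zero hk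
  -- Order by the block, then by the index `ix v` of the list containing `v` and the place in it;
  -- the last two are combined into one number by adding up the lengths of the lists.
  let ix : ℕ → ℕ := fun v => if h : ∃ i, v ∈ F i then h.choose else 0
  have hix : ∀ i, ∀ v ∈ F i, ix v = i := by
    intro i v hv
    have h : ∃ i, v ∈ F i := ⟨i, hv⟩
    by_contra hne
    have : ix v = h.choose := dif_pos h
    exact hdisj _ _ hne (this ▸ h.choose_spec) hv
  let s : ℕ → ℕ := fun i => ∑ j ∈ Finset.range i, (F j).length
  have hs : ∀ i j, i < j → s i + (F i).length ≤ s j := by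
    intro i j hij
    rw [← Finset.sum_range_succ]
    exact Finset.sum_le_sum_of_subset (Finset.range_subset_range.2 hij)
  let b : ℕ → ℕ := fun v => ix v % k
  let p : ℕ → ℕ := fun v => s (ix v) + (F (ix v)).idxOf v
  have hp : ∀ i, ∀ v ∈ F i, p v = s i + (F i).idxOf v ∧ p v < s i + (F i).length := by
    intro i v hv
    have : p v = s i + (F i).idxOf v := by simp only [p, hix i v hv]
    exact ⟨this, by have := List.idxOf_lt_length_iff.2 hv; omega⟩
  have hlt : ∀ i j, i < j → ∀ u ∈ F i, ∀ v ∈ F j, p u < p v := by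
    intro i j hij u hu v hv
    have := hp i u hu
    have := hp j v hv
    have := hs i j hij
    omega
  have hself : ∀ i, (F i).Pairwise (Str.keyStr {v | ∃ i, v ∈ F i} b p).Lt := by
    intro i
    rw [List.pairwise_iff_getElem]
    intro m n hm hn hmn
    rw [Str.keyStr_lt]
    refine ⟨⟨i, List.getElem_mem _⟩, ⟨i, List.getElem_mem _⟩, Or.inr ⟨?_, ?_⟩⟩
    · simp only [b, hix i _ (List.getElem_mem hm), hix i _ (List.getElem_mem hn)]
    · rw [(hp i _ (List.getElem_mem hm)).1, (hp i _ (List.getElem_mem hn)).1,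
        (hnd i).idxOf_getElem, (hnd i).idxOf_getElem]
      omega
  refine ⟨Str.keyStr {v | ∃ i, v ∈ F i} b p, keyStr_mem_copies ?_ ?_ ?_, ?_⟩
  · intro v _
    exact Nat.mod_lt _ hk'
  · rintro u ⟨i, hu⟩ v ⟨j, hv⟩ - h
    rcases lt_trichotomy i j with hij | rfl | hij
    · have := hlt i j hij u hu v hv; omega
    · have h1 := hp i u hu
      have h2 := hp i v hv
      exact (List.idxOf_inj hu).1 (by omega)
    · have := hlt j i hij v hv u hu; omega
  · intro r hr
    have hh : ∀ i, (F i).head (hne i) ∈ F i := fun i => List.head_mem _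
    refine Set.Infinite.mono ?_ ((infinite_residue hr 0).image (f := fun i => (F i).head (hne i)) ?_)
    · rintro _ ⟨i, hi, rfl⟩
      exact ⟨⟨i, hh i⟩, by simp only [b, hix i _ (hh i)]; exact hi.2⟩
    · intro i _ j _ hij
      have hij : (F i).head (hne i) = (F j).head (hne j) := hij
      rw [← hix i _ (hh i), hij, hix j _ (hh j)]
  · intro i j hij
    refine ⟨?_, List.pairwise_append.2 ⟨hself i, hself j, ?_⟩⟩
    · intro a ha
      exact (List.mem_append.1 ha).elim (fun h => ⟨i, h⟩) fun h => ⟨j, h⟩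
    · intro u hu v hv
      rw [Str.keyStr_lt]
      refine ⟨⟨i, hu⟩, ⟨j, hv⟩, ?_⟩
      simp only [b, hix i u hu, hix j v hv]
      exact hij.imp id fun h => ⟨h.1, hlt i j h.2 u hu v hv⟩

/-- The version of `exists_copies_of_lists` for `ω* · k`: within a block, the lists are placed in the
opposite order, but each of them keeps its own order. -/
lemma exists_copies_dual_of_lists {k : ℕ} (hk : k ≠ 0) {F : ℕ → List ℕ} (hnd : ∀ i, (F i).Nodup)
    (hne : ∀ i, F i ≠ []) (hdisj : ∀ i j, i ≠ j → (F i).Disjoint (F j)) :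
    ∃ A ∈ copies (Fin k ×ₗ ℕᵒᵈ), ∀ i j, i % k = j % k → i < j → A.HasSub (F j ++ F i) := by
  obtain ⟨A, hA, h⟩ := exists_copies_of_lists hk (F := fun i => (F i).reverse)
    (fun i => List.nodup_reverse.2 (hnd i)) (fun i => by simpa using hne i)
    (fun i j hij => fun a ha hb => hdisj i j hij (List.mem_reverse.1 ha) (List.mem_reverse.1 hb))
  refine ⟨A.rev, rev_mem_copies_dual hA, fun i j hij hlt => ?_⟩
  simpa using (h i j (Or.inr ⟨hij, hlt⟩)).rev

/-! ### Forcing by finite orders -/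

/-- `Γ` maps copies of `ω · k` to copies of `ω · t`, and copies of `ω* · k` to copies of
`ω* · t`. -/
structure PreservesOrientation (Γ : Set (Finset BasicSentence × BasicSentence)) (k t : ℕ) :
    Prop where
  omega : ∀ A ∈ copies (Fin k ×ₗ ℕ), ∃ B ∈ copies (Fin t ×ₗ ℕ), applyOp Γ A.diagram = B.diagram
  dual : ∀ A ∈ copies (Fin k ×ₗ ℕᵒᵈ), ∃ B ∈ copies (Fin t ×ₗ ℕᵒᵈ),
    applyOp Γ A.diagram = B.diagram

/-- The finite order `L` forces `φ` if `φ` is in the image under `Γ` of every copy of `ω · k` or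
`ω* · k` that extends `L`. -/
def Forces (Γ : Set (Finset BasicSentence × BasicSentence)) (k : ℕ) (L : List ℕ)
    (φ : BasicSentence) : Prop :=
  ∀ A ∈ omegaPair k, A.HasSub L → φ ∈ applyOp Γ A.diagram

section

variable {Γ : Set (Finset BasicSentence × BasicSentence)} {k t : ℕ} {L M : List ℕ} {x y z : ℕ}
  {φ : BasicSentence}

lemma Forces.mono (h : Forces Γ k L φ) (hLM : L.Sublist M) : Forces Γ k M φ :=
  fun A hA hM => h A hA (hM.sublist hLM)

/-- An enumeration operator uses finitely many sentences at a time, so whatever it outputs on a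
structure is forced by a finite suborder. -/
lemma exists_forces {A : Str} (hA : A ∈ omegaPair k) (hL : A.HasSub L)
    (hφ : φ ∈ applyOp Γ A.diagram) : ∃ M, L.Sublist M ∧ A.HasSub M ∧ Forces Γ k M φ := by
  obtain ⟨α, hα, hsub⟩ := hφ
  have hlin := isLinear_of_omegaPair hA
  obtain ⟨M, hM, hmem⟩ := hlin.exists_hasSub (α.biUnion BasicSentence.consts ∪ L.toFinset) (by
    intro a ha
    rcases Finset.mem_union.1 ha with ha | ha
    · obtain ⟨ψ, hψ, ha⟩ := Finset.mem_biUnion.1 ha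
      exact Str.consts_subset_dom (hsub ψ hψ) a ha
    · exact hL.1 a (by simpa using ha))
  refine ⟨M, hlin.sublist_of_subset hL hM fun a ha => (hmem a).2 (by simp [ha]), hM, ?_⟩
  intro B hB hMB
  refine ⟨α, hα, fun ψ hψ => ?_⟩
  refine Str.mem_diagram_of_hasSub hlin (isLinear_of_omegaPair hB) hM hMB ?_ (hsub ψ hψ)
  intro a ha
  exact (hmem a).2 (Finset.mem_union_left _ (Finset.mem_biUnion.2 ⟨ψ, hψ, ha⟩))

/-- Since a fresh end extension of `L` can be amalgamated with any `M` extending `L`, what `Γ`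
outputs on the former is compatible with whatever is forced by `M`. -/
lemma exists_amalgam {n : ℕ} (hk : k ≠ 0) (hLM : L.Sublist M) (hM : M.Nodup)
    (hn : ∀ a ∈ M, a < n) (hφ : φ ∈ applyOp Γ (extStr k L n).diagram) :
    ∃ K, K.Nodup ∧ M.Sublist K ∧ Forces Γ k K φ := by
  have hL := hM.sublist hLM
  have hA := extStr_mem hk L n
  have hlin := isLinear_of_copies hA
  obtain ⟨N, hLN, hN, hf⟩ := exists_forces (Or.inl hA) (extStr_hasSub hL n) hφ
  have hP : (extStr k L n).HasSub (N.filter (· ∉ L)) := hN.sublist List.filter_sublist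
  have hPm : ∀ a ∈ N.filter (· ∉ L), a ∉ L := fun a ha => by simpa using (List.mem_filter.1 ha).2
  have hLP := extStr_hasSub_append hL hP hPm
  have hNs : N.Sublist (L ++ N.filter (· ∉ L)) := by
    refine hlin.sublist_of_subset hN hLP fun a ha => ?_
    by_cases h : a ∈ L <;> simp [h, ha]
  refine ⟨M ++ N.filter (· ∉ L), ?_, List.sublist_append_left _ _,
    hf.mono (hNs.trans (hLM.append_right _))⟩
  refine hM.append (hlin.nodup hP) fun a ha ha' => ?_
  rcases hP.1 a ha' with h | h
  · exact hPm a ha' h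
  · exact absurd (hn a ha) (by omega)

/-- `x` belongs to the image of every structure extending `L`. -/
def Out (Γ : Set (Finset BasicSentence × BasicSentence)) (k : ℕ) (L : List ℕ) (x : ℕ) : Prop :=
  Forces Γ k L (.eq x x)

/-- `x` lies below `y` in the image of every structure extending `L`. -/
def Below (Γ : Set (Finset BasicSentence × BasicSentence)) (k : ℕ) (L : List ℕ) (x y : ℕ) : Prop :=
  Forces Γ k L (.lt x y)

namespace PreservesOrientation

variable (hΓ : PreservesOrientation Γ k t)
include hΓ

lemma out {A : Str} (hA : A ∈ omegaPair k) : ∃ B : Str, B.IsLinear ∧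
    applyOp Γ A.diagram = B.diagram := by
  rcases hA with hA | hA
  · obtain ⟨B, hB, h⟩ := hΓ.omega A hA
    exact ⟨B, isLinear_of_copies hB, h⟩
  · obtain ⟨B, hB, h⟩ := hΓ.dual A hA
    exact ⟨B, isLinear_of_copies hB, h⟩

lemma below_trans (h1 : Below Γ k L x y) (h2 : Below Γ k L y z) : Below Γ k L x z := by
  intro A hA hL
  obtain ⟨B, hB, h⟩ := hΓ.out hA
  have h1 := h1 A hA hL
  have h2 := h2 A hA hL
  rw [h] at h1 h2 ⊢
  exact hB.trans _ _ _ h1 h2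

lemma below_asymm (hk : k ≠ 0) (hL : L.Nodup) (h1 : Below Γ k L x y) : ¬ Below Γ k L y x := by
  intro h2
  have hA : extStr k L 0 ∈ omegaPair k := Or.inl (extStr_mem hk L 0)
  obtain ⟨B, hB, h⟩ := hΓ.out hA
  have h1 := h1 _ hA (extStr_hasSub hL 0)
  have h2 := h2 _ hA (extStr_hasSub hL 0)
  rw [h] at h1 h2
  exact hB.asymm h1 h2

/-- Any two elements whose existence is forced by `L` are already compared by `L`. -/
lemma below_total (hk : k ≠ 0) (hL : L.Nodup) (hx : Out Γ k L x) (hy : Out Γ k L y)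
    (hxy : x ≠ y) : Below Γ k L x y ∨ Below Γ k L y x := by
  have aux : ∀ x y, Out Γ k L x → Out Γ k L y → x ≠ y → ¬ Below Γ k L x y →
      ∃ M, L.Sublist M ∧ M.Nodup ∧ Below Γ k M y x := by
    intro x y hx hy hxy h
    simp only [Below, Forces] at h
    push Not at h
    obtain ⟨A, hA, hLA, h⟩ := h
    obtain ⟨B, hB, hAB⟩ := hΓ.out hA
    have hx := hx A hA hLA
    have hy := hy A hA hLA
    rw [hAB] at h hx hy
    have hlt := (hB.total x (Str.eq_mem_diagram.1 hx) y (Str.eq_mem_diagram.1 hy) hxy).resolve_left h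
    obtain ⟨M, hLM, hM, hf⟩ := exists_forces hA hLA (φ := .lt y x) (by rw [hAB]; exact hlt)
    exact ⟨M, hLM, (isLinear_of_omegaPair hA).nodup hM, hf⟩
  by_contra hcon
  rw [not_or] at hcon
  obtain ⟨M, hLM, hM, hMf⟩ := aux x y hx hy hxy hcon.1
  obtain ⟨N, hLN, hN, hNf⟩ := aux y x hy hx hxy.symm hcon.2
  obtain ⟨n, hn⟩ : ∃ n, ∀ a ∈ M ++ N, a < n :=
    ⟨(M ++ N).sum + 1, fun a ha => Nat.lt_succ_of_le (List.le_sum_of_mem ha)⟩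
  have hA : extStr k L n ∈ omegaPair k := Or.inl (extStr_mem hk L n)
  have hLA := extStr_hasSub (k := k) hL n
  obtain ⟨B, hB, hAB⟩ := hΓ.out hA
  have hxB := hx _ hA hLA
  have hyB := hy _ hA hLA
  rw [hAB] at hxB hyB
  rcases hB.total x (Str.eq_mem_diagram.1 hxB) y (Str.eq_mem_diagram.1 hyB) hxy with h | h
  · obtain ⟨K, hK, hMK, hf⟩ := exists_amalgam (Γ := Γ) (φ := .lt x y) hk hLM hM
      (fun a ha => hn a (List.mem_append_left _ ha)) (by rw [hAB]; exact h)
    exact hΓ.below_asymm hk hK hf (hMf.mono hMK)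
  · obtain ⟨K, hK, hMK, hf⟩ := exists_amalgam (Γ := Γ) (φ := .lt y x) hk hLN hN
      (fun a ha => hn a (List.mem_append_right _ ha)) (by rw [hAB]; exact h)
    exact hΓ.below_asymm hk hK hf (hNf.mono hMK)

lemma below_of_not (hk : k ≠ 0) (hL : L.Nodup) (hx : Out Γ k L x) (hy : Out Γ k L y)
    (hxy : x ≠ y) (h : ¬ Below Γ k L x y) : Below Γ k L y x :=
  (hΓ.below_total hk hL hx hy hxy).resolve_left h

end PreservesOrientation

end

/-! ### Infinite combinatorics -/

/-- Ramsey's theorem for pairs, applied to finitely many relations at once. -/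
lemma exists_homogeneous {ι : Type*} [Finite ι] (c : ι → ℕ → ℕ → Prop) :
    ∃ g : ℕ → ℕ, StrictMono g ∧ ∃ V : ι → Prop, ∀ s i j, i < j → (c s (g i) (g j) ↔ V s) := by
  -- The colour `V s` of the relation `s` is read off along a nonprincipal ultrafilter.
  let U : Ultrafilter ℕ := Filter.hyperfilter ℕ
  let V : ι → Prop := fun s => ∀ᶠ i in U, ∀ᶠ j in U, c s i j
  have hiff : ∀ (p : ℕ → Prop) (q : Prop), ((∀ᶠ j in U, p j) ↔ q) → ∀ᶠ j in U, (p j ↔ q) := by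
    intro p q h
    by_cases hq : q
    · filter_upwards [h.2 hq] with j hj using iff_of_true hj hq
    · filter_upwards [Ultrafilter.eventually_not.2 fun h' => hq (h.1 h')] with j hj
        using iff_of_false hj hq
  have hV : ∀ᶠ i in U, ∀ᶠ j in U, ∀ s, (c s i j ↔ V s) := by
    have : ∀ᶠ i in U, ∀ s, ((∀ᶠ j in U, c s i j) ↔ V s) :=
      Filter.eventually_all.2 fun s => hiff _ _ Iff.rfl
    filter_upwards [this] with i hi
    exact Filter.eventually_all.2 fun s => hiff _ _ (hi s)
  have hgt : ∀ n : ℕ, ∀ᶠ j in (U : Filter ℕ), n < j := fun n => by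
    have : ∀ᶠ j in Filter.cofinite, n < j := by
      rw [Nat.cofinite_eq_atTop]; exact Filter.eventually_gt_atTop n
    exact Filter.hyperfilter_le_cofinite this
  obtain ⟨g, -, hg⟩ := exists_seq_of_forall_finset_exists
    (fun i => ∀ᶠ j in U, ∀ s, (c s i j ↔ V s)) (fun i j => i < j ∧ ∀ s, (c s i j ↔ V s)) (by
      intro S hS
      have h1 : ∀ᶠ j in U, ∀ i ∈ S, i < j ∧ ∀ s, (c s i j ↔ V s) :=
        (Filter.eventually_all_finset S).2 fun i hi => (hgt i).and (hS i hi)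
      exact (hV.and h1).exists)
  exact ⟨g, fun i j hij => (hg i j hij).1, V, fun s i j hij => (hg i j hij).2 s⟩

/-- If `ω · k · |M|` embeds into `ω · t`, then `k · |M| ≤ t`. -/
lemma card_mul_le_of_strictMono {M : Type} [LinearOrder M] [Fintype M] {k t : ℕ}
    (f : M ×ₗ (Fin k ×ₗ ℕ) → Fin t ×ₗ ℕ) (hf : StrictMono f) : Fintype.card M * k ≤ t := by
  have h1 : Ordinal.type (Prod.Lex ((· < ·) : M → M → Prop)
      (Prod.Lex ((· < ·) : Fin k → Fin k → Prop) ((· < ·) : ℕ → ℕ → Prop))) ≤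
      Ordinal.type (Prod.Lex ((· < ·) : Fin t → Fin t → Prop) ((· < ·) : ℕ → ℕ → Prop)) := by
    rw [Ordinal.type_le_iff']
    exact ⟨RelEmbedding.ofMonotone (fun x => ofLex (f (toLex (x.1, toLex x.2))))
      fun x y h => hf h⟩
  rw [Ordinal.type_prod_lex, Ordinal.type_prod_lex, Ordinal.type_prod_lex,
    Ordinal.type_fintype ((· < ·) : M → M → Prop),
    Ordinal.type_fintype ((· < ·) : Fin k → Fin k → Prop),
    Ordinal.type_fintype ((· < ·) : Fin t → Fin t → Prop), mul_assoc] at h1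
  have h2 := (mul_le_mul_iff_right₀ (a := Ordinal.type ((· < ·) : ℕ → ℕ → Prop)) ?_).1 h1
  · rw [Fintype.card_fin, Fintype.card_fin] at h2
    rw [mul_comm]
    exact_mod_cast h2
  · rw [Ordinal.type_nat_lt]; exact Ordinal.omega0_pos

/-- A strictly increasing self-map of `ω · t` maps every block cofinally into itself. -/
lemma exists_block_eq {t : ℕ} {f : Fin t ×ₗ ℕ → Fin t ×ₗ ℕ} (hf : StrictMono f) (a : Fin t)
    (n : ℕ) : ∃ j, (ofLex (f (toLex (a, j)))).1 = a ∧ n ≤ (ofLex (f (toLex (a, j)))).2 := by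
  set B : Fin t → ℕ → Fin t := fun a j => (ofLex (f (toLex (a, j)))).1 with hB
  set c : Fin t → ℕ → ℕ := fun a j => (ofLex (f (toLex (a, j)))).2 with hc
  have hlt : ∀ a j a' j', (a < a' ∨ a = a' ∧ j < j') →
      B a j < B a' j' ∨ B a j = B a' j' ∧ c a j < c a' j' := by
    intro a j a' j' h
    have := @hf (toLex (a, j)) (toLex (a', j')) (Prod.Lex.lt_iff.2 h)
    exact Prod.Lex.lt_iff.1 this
  have hge : ∀ a j, a < B a j ∨ a = B a j ∧ j ≤ c a j := by
    intro a j
    have := hf.le_apply (x := toLex (a, j))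
    exact Prod.Lex.le_iff.1 this
  -- A block cannot be pushed up: otherwise all later blocks would be pushed up as well.
  have hup : ∀ a j, B a j = a := by
    intro a
    induction h : t - a.1 using Nat.strong_induction_on generalizing a with
    | _ d ih =>
      intro j
      by_contra hne
      have hgt : a < B a j := (hge a j).resolve_right fun h => hne h.1.symm
      have hlt' : a.1 + 1 < t := lt_of_le_of_lt hgt (B a j).2
      let a' : Fin t := ⟨a.1 + 1, hlt'⟩
      have haa : a < a' := Nat.lt_succ_self a.1
      have hB' : B a' 0 = a' := ih (t - (a.1 + 1)) (by omega) a' rfl 0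
      have hall : ∀ i, B a (j + i) = a' ∧ i ≤ c a (j + i) := by
        intro i
        induction i with
        | zero =>
          refine ⟨le_antisymm ?_ hgt, Nat.zero_le _⟩
          rcases hlt a (j + 0) a' 0 (Or.inl haa) with h | h
          · exact (hB' ▸ h).le
          · exact (h.1.trans hB').le
        | succ i ihi =>
          have h1 : B a (j + (i + 1)) ≤ a' := by
            rcases hlt a (j + (i + 1)) a' 0 (Or.inl haa) with h | h
            · exact (hB' ▸ h).le
            · exact (h.1.trans hB').le
          rcases hlt a (j + i) a (j + (i + 1)) (Or.inr ⟨rfl, by omega⟩) with h | h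
          · exact absurd (ihi.1 ▸ h) h1.not_gt
          · exact ⟨h.1.symm.trans ihi.1, by omega⟩
      have h1 := hall (c a' 0)
      rcases hlt a (j + c a' 0) a' 0 (Or.inl haa) with h | h
      · rw [h1.1, hB'] at h; exact lt_irrefl _ h
      · omega
  refine ⟨n, hup a n, ?_⟩
  rcases hge a n with h | h
  · exact absurd h (by rw [hup]; exact lt_irrefl _)
  · exact h.2

/-! ### A sequence of finite pieces of a copy of `ω · k` -/

/-- The finite order consisting of the parts `f 0, …, f (k - 1)`, in this order. -/
def row (k : ℕ) (f : ℕ → List ℕ) : List ℕ := (List.range k).flatMap f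

/-- The shuffle of two rows in which, for each `r`, the part `f r` is followed by `g r`. -/
def weave (k : ℕ) (f g : ℕ → List ℕ) : List ℕ := (List.range k).flatMap fun r => f r ++ g r

/-- The row of `f`, with the whole row of `g` inserted after the first `p` parts. -/
def insertRow (k p : ℕ) (f g : ℕ → List ℕ) : List ℕ :=
  (List.range p).flatMap f ++ row k g ++ (List.range' p (k - p)).flatMap f

/-- A sequence of disjoint finite orders `row k (F i)`, the `r`-th parts `F i r` being consecutive
pieces of the `r`-th block of a copy of `ω · k`, together with elements `x i a` that `row k (F i)`
puts into the `a`-th block of the image of that copy. -/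
structure Pieces (Γ : Set (Finset BasicSentence × BasicSentence)) (k t : ℕ) (F : ℕ → ℕ → List ℕ)
    (x : ℕ → Fin t → ℕ) : Prop where
  ne_nil : ∀ i, row k (F i) ≠ []
  disj : ∀ i j, i ≠ j → (row k (F i)).Disjoint (row k (F j))
  nodup : ∀ i j, i < j → (weave k (F i) (F j)).Nodup
  out : ∀ i a, Out Γ k (row k (F i)) (x i a)
  inj : ∀ i j a b, i ≠ j → x i a ≠ x j b
  below : ∀ i j a b, i < j → a < b → Below Γ k (weave k (F i) (F j)) (x j a) (x i b)

lemma Pieces.comp {Γ : Set (Finset BasicSentence × BasicSentence)} {k t : ℕ} {F : ℕ → ℕ → List ℕ}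
    {x : ℕ → Fin t → ℕ} (h : Pieces Γ k t F x) {g : ℕ → ℕ} (hg : StrictMono g) :
    Pieces Γ k t (fun i => F (g i)) (fun i => x (g i)) where
  ne_nil _ := h.ne_nil _
  disj _ _ hij := h.disj _ _ (hg.injective.ne hij)
  nodup _ _ hij := h.nodup _ _ (hg hij)
  out _ := h.out _
  inj _ _ _ _ hij := h.inj _ _ _ _ (hg.injective.ne hij)
  below _ _ _ _ hij := h.below _ _ _ _ (hg hij)

/-- The names in `[s, e)` of residue `r` modulo `k`. -/
def seg (k s e r : ℕ) : List ℕ := (List.range' s (e - s)).filter (· % k = r)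

lemma mem_seg {k s e r v : ℕ} : v ∈ seg k s e r ↔ (s ≤ v ∧ v < e) ∧ v % k = r := by
  simp only [seg, List.mem_filter, List.mem_range'_1, decide_eq_true_eq]
  constructor <;> rintro ⟨h1, h2⟩ <;> exact ⟨by omega, h2⟩

lemma mem_row_seg {k s e v : ℕ} (hk : k ≠ 0) : v ∈ row k (seg k s e) ↔ s ≤ v ∧ v < e := by
  simp only [row, List.mem_flatMap, List.mem_range, mem_seg]
  exact ⟨fun ⟨r, _, h, _⟩ => h, fun h => ⟨v % k, Nat.mod_lt _ (Nat.pos_of_ne_zero hk), h, rfl⟩⟩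

lemma extStr_nil_lt {k n u v : ℕ} : (extStr k [] n).Lt u v ↔
    n ≤ u ∧ n ≤ v ∧ (u % k < v % k ∨ u % k = v % k ∧ u < v) := by
  simp [extStr, Str.keyStr_lt]

lemma pairwise_seg {k s e r : ℕ} : (seg k s e r).Pairwise (extStr k [] 0).Lt := by
  have h : (seg k s e r).Pairwise (· < ·) := (List.pairwise_lt_range' (s := s)).filter _
  refine h.imp_of_mem fun {a b} ha hb hab => ?_
  rw [extStr_nil_lt]
  exact ⟨Nat.zero_le _, Nat.zero_le _, Or.inr ⟨(mem_seg.1 ha).2.trans (mem_seg.1 hb).2.symm, hab⟩⟩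

lemma hasSub_row_seg {k s e : ℕ} : (extStr k [] 0).HasSub (row k (seg k s e)) := by
  refine ⟨fun a _ => Or.inr (Nat.zero_le a), List.pairwise_flatMap.2 ⟨fun r _ => pairwise_seg, ?_⟩⟩
  refine List.pairwise_lt_range.imp fun {r r'} hr u hu v hv => ?_
  rw [extStr_nil_lt, (mem_seg.1 hu).2, (mem_seg.1 hv).2]
  exact ⟨Nat.zero_le _, Nat.zero_le _, Or.inl hr⟩

lemma hasSub_weave_seg {k s e s' e' : ℕ} (h : e ≤ s') :
    (extStr k [] 0).HasSub (weave k (seg k s e) (seg k s' e')) := by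
  refine ⟨fun a _ => Or.inr (Nat.zero_le a), List.pairwise_flatMap.2 ⟨fun r _ => ?_, ?_⟩⟩
  · refine List.pairwise_append.2 ⟨pairwise_seg, pairwise_seg, fun u hu v hv => ?_⟩
    have hu := mem_seg.1 hu
    have hv := mem_seg.1 hv
    rw [extStr_nil_lt]
    exact ⟨Nat.zero_le _, Nat.zero_le _, Or.inr ⟨hu.2.trans hv.2.symm, by omega⟩⟩
  · have hmem : ∀ r v, v ∈ seg k s e r ++ seg k s' e' r → v % k = r := fun r v hv =>
      (List.mem_append.1 hv).elim (fun h => (mem_seg.1 h).2) fun h => (mem_seg.1 h).2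
    refine List.pairwise_lt_range.imp fun {r r'} hr u hu v hv => ?_
    rw [extStr_nil_lt, hmem _ _ hu, hmem _ _ hv]
    exact ⟨Nat.zero_le _, Nat.zero_le _, Or.inl hr⟩

lemma row_sublist_weave_left (k : ℕ) (f g : ℕ → List ℕ) : (row k f).Sublist (weave k f g) :=
  List.Sublist.flatMap_right _ fun _ _ => List.sublist_append_left _ _

lemma row_sublist_weave_right (k : ℕ) (f g : ℕ → List ℕ) : (row k g).Sublist (weave k f g) :=
  List.Sublist.flatMap_right _ fun _ _ => List.sublist_append_right _ _

namespace PreservesOrientation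

variable {Γ : Set (Finset BasicSentence × BasicSentence)} {k t : ℕ}

/-- Beyond any bound `n` one finds a finite piece of the standard copy of `ω · k` that puts an
element of large rank into each block of the image. This holds because removing the names below `n`
leaves a copy of `ω · k`, whose image is a copy of `ω · t` inside `B`. -/
lemma exists_next (hΓ : PreservesOrientation Γ k t) (hk : k ≠ 0) {B : Str}
    (hB : applyOp Γ (extStr k [] 0).diagram = B.diagram)
    (e : B.lt ≃r ((· < ·) : Fin t ×ₗ ℕ → Fin t ×ₗ ℕ → Prop)) (n : ℕ) :
    ∃ n', n < n' ∧ ∃ x : Fin t → ℕ, ∀ a, Out Γ k (row k (seg k n n')) (x a) ∧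
      ∃ hx : x a ∈ B.dom, (ofLex (e ⟨x a, hx⟩)).1 = a ∧ n ≤ (ofLex (e ⟨x a, hx⟩)).2 ∧
        (ofLex (e ⟨x a, hx⟩)).2 < n' := by
  have hC := extStr_mem hk [] 0
  have hCn := extStr_mem hk [] n
  have hlin := isLinear_of_copies hC
  have hsub : ∀ L, (extStr k [] n).HasSub L → (extStr k [] 0).HasSub L := by
    intro L hL
    refine ⟨fun a _ => Or.inr (Nat.zero_le a), hL.2.imp fun h => ?_⟩
    rw [extStr_nil_lt] at h ⊢
    exact ⟨Nat.zero_le _, Nat.zero_le _, h.2.2⟩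
  obtain ⟨B', ⟨e'⟩, hB'⟩ := hΓ.omega _ hCn
  have hincl : ∀ φ, φ ∈ B'.diagram → φ ∈ B.diagram := by
    intro φ hφ
    rw [← hB'] at hφ
    obtain ⟨L, -, hL, hf⟩ := exists_forces (Or.inl hCn) (extStr_hasSub List.nodup_nil n) hφ
    rw [← hB]
    exact hf _ (Or.inl hC) (hsub L hL)
  have hdom : ∀ v ∈ B'.dom, v ∈ B.dom := fun v hv =>
    Str.eq_mem_diagram.1 (hincl _ (Str.eq_mem_diagram.2 hv))
  let f : Fin t ×ₗ ℕ → Fin t ×ₗ ℕ := fun z => e ⟨e'.symm z, hdom _ (e'.symm z).2⟩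
  have hf : StrictMono f := by
    intro z w hzw
    refine e.map_rel_iff.2 ?_
    have h1 : B'.Lt (e'.symm z) (e'.symm w) :=
      ⟨(e'.symm z).2, (e'.symm w).2, e'.symm.map_rel_iff.2 hzw⟩
    have h2 : B.Lt (e'.symm z) (e'.symm w) := hincl (.lt _ _) h1
    exact h2.2.2
  choose j hj1 hj2 using fun a => exists_block_eq hf a n
  let x : Fin t → ℕ := fun a => e'.symm (toLex (a, j a))
  have hx' : ∀ a, x a ∈ B'.dom := fun a => (e'.symm (toLex (a, j a))).2
  have hL : ∀ a, ∃ L, (extStr k [] n).HasSub L ∧ Out Γ k L (x a) := by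
    intro a
    obtain ⟨L, -, hL, hf⟩ := exists_forces (φ := .eq (x a) (x a)) (Or.inl hCn)
      (extStr_hasSub List.nodup_nil n) (by rw [hB']; exact Str.eq_mem_diagram.2 (hx' a))
    exact ⟨L, hL, hf⟩
  choose L hL hout using hL
  let c : Fin t → ℕ := fun a => (ofLex (f (toLex (a, j a)))).2 + (L a).sum
  have hc : ∀ a, c a < n + 1 + ∑ a, c a := fun a => by
    have := Finset.single_le_sum (f := c) (fun _ _ => Nat.zero_le _) (Finset.mem_univ a)
    omega
  refine ⟨n + 1 + ∑ a, c a, by omega, x, fun a => ⟨(hout a).mono ?_, hdom _ (hx' a), hj1 a, hj2 a,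
    lt_of_le_of_lt (Nat.le_add_right _ _) (hc a)⟩⟩
  refine hlin.sublist_of_subset (hsub _ (hL a)) hasSub_row_seg fun v hv => ?_
  rw [mem_row_seg hk]
  have h1 : v ≤ (L a).sum := List.le_sum_of_mem hv
  have h2 : (L a).sum ≤ c a := Nat.le_add_left _ _
  have h3 := hc a
  have h4 : n ≤ v := ((hL a).1 v hv).resolve_left (by simp)
  exact ⟨h4, by omega⟩

lemma exists_pieces (hΓ : PreservesOrientation Γ k t) (hk : k ≠ 0) :
    ∃ F x, Pieces Γ k t F x := by
  have hC := extStr_mem hk [] 0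
  have hlin := isLinear_of_copies hC
  obtain ⟨B, hBt, hB⟩ := hΓ.omega _ hC
  have hBlin := isLinear_of_copies hBt
  obtain ⟨e⟩ := hBt
  choose g hg x hout hdom hblock hge hlt using hΓ.exists_next hk hB e
  let n : ℕ → ℕ := fun i => g^[i] 0
  have hn : ∀ i, n (i + 1) = g (n i) := fun i => Function.iterate_succ_apply' g i 0
  have hnmono : StrictMono n := strictMono_nat_of_lt_succ fun i => by rw [hn]; exact hg _
  have hle : ∀ i j, i < j → g (n i) ≤ n j := fun i j hij => by
    rw [← hn]; exact hnmono.monotone hij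
  have hrank : ∀ i j a b, i < j → (ofLex (e ⟨x (n i) a, hdom _ _⟩)).2 <
      (ofLex (e ⟨x (n j) b, hdom _ _⟩)).2 := fun i j a b hij =>
    (hlt (n i) a).trans_le ((hle i j hij).trans (hge (n j) b))
  have hne : ∀ i j a b, i < j → x (n i) a ≠ x (n j) b := by
    intro i j a b hij h
    have := hrank i j a b hij
    simp only [h, lt_irrefl] at this
  refine ⟨fun i => seg k (n i) (g (n i)), fun i => x (n i), ?_, ?_, ?_, ?_, ?_, ?_⟩
  · intro i
    exact List.ne_nil_of_mem ((mem_row_seg hk).2 ⟨le_rfl, hg (n i)⟩)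
  · intro i j hij v hv hv'
    rw [mem_row_seg hk] at hv hv'
    rcases lt_or_gt_of_ne hij with h | h
    · have := hle i j h; omega
    · have := hle j i h; omega
  · intro i j hij
    exact hlin.nodup (hasSub_weave_seg (hle i j hij))
  · exact fun i a => hout (n i) a
  · intro i j a b hij
    rcases lt_or_gt_of_ne hij with h | h
    · exact hne i j a b h
    · exact (hne j i b a h).symm
  · intro i j a b hij hab
    have hW := hasSub_weave_seg (k := k) (s := n i) (e' := g (n j)) (hle i j hij)
    by_contra hcon
    have h := hΓ.below_of_not hk (hlin.nodup hW)
      ((hout (n j) a).mono (row_sublist_weave_right _ _ _))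
      ((hout (n i) b).mono (row_sublist_weave_left _ _ _)) (hne i j b a hij).symm hcon
    have h1 := h _ (Or.inl hC) hW
    rw [hB] at h1
    have h2 := e.map_rel_iff.2 h1.2.2
    rw [Prod.Lex.lt_iff, hblock, hblock] at h2
    rcases h2 with h2 | h2
    · exact h2.not_gt hab
    · exact hab.ne' h2.1

end PreservesOrientation

/-! ### Comparing pieces placed one after the other -/

lemma Str.not_descending {t : ℕ} {B : Str} (hB : B ∈ copies (Fin t ×ₗ ℕ)) (s : ℕ → ℕ)
    (h : ∀ i j, i < j → B.Lt (s j) (s i)) : False := by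
  obtain ⟨e⟩ := hB
  have hd : ∀ i, s i ∈ B.dom := fun i => (h i (i + 1) (Nat.lt_succ_self i)).right
  exact not_strictAnti_of_wellFoundedLT (fun i => e ⟨s i, hd i⟩)
    fun i j hij => e.map_rel_iff.2 (h i j hij).2.2

lemma Str.not_ascending {t : ℕ} {B : Str} (hB : B ∈ copies (Fin t ×ₗ ℕᵒᵈ)) (s : ℕ → ℕ)
    (h : ∀ i j, i < j → B.Lt (s i) (s j)) : False :=
  Str.not_descending (rev_mem_copies hB) s fun i j hij => Str.rev_lt.2 (h i j hij)

/-- A sequence of finite orders `G i` with elements `x i a` such that the comparison of `x i a`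
with `x j b`, `i < j`, does not depend on `i` and `j`, neither when `G i` is placed before `G j`
(relation `K`) nor when it is placed after `G j` (relation `W`). -/
structure Homogeneous (Γ : Set (Finset BasicSentence × BasicSentence)) (k t : ℕ) (G : ℕ → List ℕ)
    (x : ℕ → Fin t → ℕ) (K W : Fin t → Fin t → Prop) : Prop where
  ne_nil : ∀ i, G i ≠ []
  disj : ∀ i j, i ≠ j → (G i).Disjoint (G j)
  nodup : ∀ i, (G i).Nodup
  out : ∀ i a, Out Γ k (G i) (x i a)
  inj : ∀ i j a b, i ≠ j → x i a ≠ x j b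
  before : ∀ i j a b, i < j → (Below Γ k (G i ++ G j) (x i a) (x j b) ↔ K a b)
  after : ∀ i j a b, i < j → (Below Γ k (G j ++ G i) (x i a) (x j b) ↔ W a b)

namespace Homogeneous

variable {Γ : Set (Finset BasicSentence × BasicSentence)} {k t : ℕ} {G : ℕ → List ℕ}
  {x : ℕ → Fin t → ℕ} {K W : Fin t → Fin t → Prop} {a b c : Fin t} {i j l : ℕ}

section

variable (hH : Homogeneous Γ k t G x K W)
include hH

lemma nodup_append (hij : i ≠ j) : (G i ++ G j).Nodup :=
  (hH.nodup i).append (hH.nodup j) (hH.disj i j hij)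

lemma out_left : Out Γ k (G i ++ G j) (x i a) := (hH.out i a).mono (List.sublist_append_left _ _)

lemma out_right : Out Γ k (G i ++ G j) (x j a) := (hH.out j a).mono (List.sublist_append_right _ _)

variable (hΓ : PreservesOrientation Γ k t) (hk : k ≠ 0)
include hΓ hk

lemma before_not (h : ¬ K a b) (hij : i < j) : Below Γ k (G i ++ G j) (x j b) (x i a) :=
  hΓ.below_of_not hk (hH.nodup_append hij.ne) hH.out_left hH.out_right (hH.inj _ _ _ _ hij.ne)
    fun h' => h ((hH.before i j a b hij).1 h')

lemma after_not (h : ¬ W a b) (hij : i < j) : Below Γ k (G j ++ G i) (x j b) (x i a) :=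
  hΓ.below_of_not hk (hH.nodup_append hij.ne') hH.out_right hH.out_left (hH.inj _ _ _ _ hij.ne)
    fun h' => h ((hH.after i j a b hij).1 h')

/-- In the arrangement `G i, G j, G l`, no cyclic chain of comparisons is possible. -/
lemma no_cycle (hij : i ≠ j) (hil : i ≠ l) (hjl : j ≠ l) {u v w : ℕ}
    (h1 : Below Γ k (G i ++ G j) u v ∨ Below Γ k (G i ++ G l) u v ∨ Below Γ k (G j ++ G l) u v)
    (h2 : Below Γ k (G i ++ G j) v w ∨ Below Γ k (G i ++ G l) v w ∨ Below Γ k (G j ++ G l) v w)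
    (h3 : Below Γ k (G i ++ G j) w u ∨ Below Γ k (G i ++ G l) w u ∨ Below Γ k (G j ++ G l) w u) :
    False := by
  have hnd : (G i ++ (G j ++ G l)).Nodup :=
    (hH.nodup i).append (hH.nodup_append hjl) fun v hv hv' => (List.mem_append.1 hv').elim
      (fun h => hH.disj i j hij hv h) fun h => hH.disj i l hil hv h
  have lift : ∀ {u v}, (Below Γ k (G i ++ G j) u v ∨ Below Γ k (G i ++ G l) u v ∨
      Below Γ k (G j ++ G l) u v) → Below Γ k (G i ++ (G j ++ G l)) u v := by
    rintro u v (h | h | h)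
    · exact h.mono ((List.sublist_append_left _ _).append_left _)
    · exact h.mono ((List.sublist_append_right _ _).append_left _)
    · exact h.mono (List.sublist_append_right _ _)
  exact hΓ.below_asymm hk hnd (hΓ.below_trans (lift h1) (lift h2)) (lift h3)

/-- Otherwise the sequence `x i a` would be descending in the image of a copy of `ω · k`. -/
lemma before_self (a : Fin t) : K a a := by
  by_contra hK
  obtain ⟨A, hA, hF⟩ := exists_copies_of_lists hk hH.nodup hH.ne_nil hH.disj
  obtain ⟨B, hB, hAB⟩ := hΓ.omega A hA
  refine Str.not_descending hB (fun i => x (k * i) a) fun i j hij => ?_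
  have hij' : k * i < k * j := Nat.mul_lt_mul_of_pos_left hij (Nat.pos_of_ne_zero hk)
  have := hH.before_not hΓ hk hK hij' A (Or.inl hA) (hF _ _ (Or.inr ⟨by simp, hij'⟩))
  rwa [hAB] at this

/-- Otherwise the sequence `x i a` would be ascending in the image of a copy of `ω* · k`. -/
lemma after_self (a : Fin t) : ¬ W a a := by
  intro hW
  obtain ⟨A, hA, hF⟩ := exists_copies_dual_of_lists hk hH.nodup hH.ne_nil hH.disj
  obtain ⟨B, hB, hAB⟩ := hΓ.dual A hA
  refine Str.not_ascending hB (fun i => x (k * i) a) fun i j hij => ?_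
  have hij' : k * i < k * j := Nat.mul_lt_mul_of_pos_left hij (Nat.pos_of_ne_zero hk)
  have := (hH.after _ _ a a hij').2 hW A (Or.inr hA) (hF _ _ (by simp) hij')
  rwa [hAB] at this

/-- Place the pieces `0, 1, 2` in this order. -/
lemma before_trans (h1 : K a b) (h2 : K b c) : K a c := by
  by_contra h
  exact hH.no_cycle hΓ hk (i := 0) (j := 1) (l := 2) (by omega) (by omega) (by omega)
    (Or.inl ((hH.before 0 1 a b (by omega)).2 h1))
    (Or.inr (Or.inr ((hH.before 1 2 b c (by omega)).2 h2)))
    (Or.inr (Or.inl (hH.before_not hΓ hk h (by omega))))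

/-- Otherwise `x 2 a < x 1 b < x 0 a < x 2 a` if the pieces are placed in the order `0, 1, 2`. -/
lemma before_total (a b : Fin t) : K a b ∨ K b a := by
  by_contra h
  rw [not_or] at h
  exact hH.no_cycle hΓ hk (i := 0) (j := 1) (l := 2) (by omega) (by omega) (by omega)
    (Or.inr (Or.inr (hH.before_not hΓ hk h.2 (i := 1) (j := 2) (by omega))))
    (Or.inl (hH.before_not hΓ hk h.1 (i := 0) (j := 1) (by omega)))
    (Or.inr (Or.inl ((hH.before 0 2 a a (by omega)).2 (hH.before_self hΓ hk a))))

/-- Otherwise `x 0 a < x 1 b < x 2 a < x 0 a` if the pieces are placed in the order `1, 2, 0`. -/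
lemma not_after_of_before (h1 : K b a) : ¬ W a b := by
  intro h
  exact hH.no_cycle hΓ hk (i := 1) (j := 2) (l := 0) (by omega) (by omega) (by omega)
    (Or.inr (Or.inl ((hH.after 0 1 a b (by omega)).2 h)))
    (Or.inl ((hH.before 1 2 b a (by omega)).2 h1))
    (Or.inr (Or.inr (hH.after_not hΓ hk (hH.after_self hΓ hk a) (by omega))))

/-- Otherwise `x 2 a < x 1 b < x 0 a < x 2 a` if the pieces are placed in the order `1, 0, 2`. -/
lemma after_of_not_before (h : ¬ K b a) : W a b := by
  by_contra hW
  exact hH.no_cycle hΓ hk (i := 1) (j := 0) (l := 2) (by omega) (by omega) (by omega)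
    (Or.inr (Or.inl (hH.before_not hΓ hk h (i := 1) (j := 2) (by omega))))
    (Or.inl (hH.after_not hΓ hk hW (i := 0) (j := 1) (by omega)))
    (Or.inr (Or.inr ((hH.before 0 2 a a (by omega)).2 (hH.before_self hΓ hk a))))

/-- If the class of `a` is strictly below the class of `b`, then `x i a` lies below `x j b`, no
matter how the pieces `i ≠ j` are placed relative to each other. -/
lemma below_of_not_before (h : ¬ K b a) {A B : Str} (hA : A ∈ omegaPair k)
    (hAB : applyOp Γ A.diagram = B.diagram) (hij : i ≠ j) (hs : A.HasSub (G i ++ G j)) :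
    B.Lt (x i a) (x j b) ∧ B.Lt (x j a) (x i b) := by
  have hK : K a b := (hH.before_total hΓ hk a b).resolve_right h
  rcases lt_or_gt_of_ne hij with hlt | hlt
  · have h1 := (hH.before i j a b hlt).2 hK A hA hs
    have h2 := hH.before_not hΓ hk h hlt A hA hs
    rw [hAB] at h1 h2
    exact ⟨h1, h2⟩
  · have h1 := hH.after_not hΓ hk (hH.not_after_of_before hΓ hk hK) hlt A hA hs
    have h2 := (hH.after j i a b hlt).2 (hH.after_of_not_before hΓ hk h) A hA hs
    rw [hAB] at h1 h2
    exact ⟨h1, h2⟩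

/-- Elements of the same index `a` are ordered in the same way as their pieces are placed. -/
lemma below_of_self {A B : Str} (hA : A ∈ omegaPair k)
    (hAB : applyOp Γ A.diagram = B.diagram) (hij : i ≠ j) (hs : A.HasSub (G i ++ G j)) :
    B.Lt (x i a) (x j a) := by
  rcases lt_or_gt_of_ne hij with hlt | hlt
  · have h1 := (hH.before i j a a hlt).2 (hH.before_self hΓ hk a) A hA hs
    rwa [hAB] at h1
  · have h1 := hH.after_not hΓ hk (hH.after_self hΓ hk a) hlt A hA hs
    rwa [hAB] at h1

/-- If `M` indexes strictly increasing classes of the preorder `K`, then distributing the pieces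
over the `k` blocks of a copy of `ω · k` gives `k` blocks of the image for each class. -/
lemma card_mul_le {M : Type} [LinearOrder M] [Fintype M] (rep : M → Fin t)
    (hrep : ∀ m m', m < m' → ¬ K (rep m') (rep m)) : Fintype.card M * k ≤ t := by
  obtain ⟨A, hA, hF⟩ := exists_copies_of_lists hk hH.nodup hH.ne_nil hH.disj
  obtain ⟨B, hB, hAB⟩ := hΓ.omega A hA
  have hlin := isLinear_of_copies hB
  obtain ⟨e⟩ := hB
  have hA' : A ∈ omegaPair k := Or.inl hA
  let ix : Fin k × ℕ → ℕ := fun z => k * z.2 + z.1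
  have hmod : ∀ z, ix z % k = z.1 := fun z => by
    simp only [ix, Nat.mul_add_mod, Nat.mod_eq_of_lt z.1.2]
  have hix : Function.Injective ix := by
    intro z w h
    have h1 : z.1 = w.1 := Fin.ext (by rw [← hmod z, ← hmod w, h])
    have h2 : k * z.2 = k * w.2 := by simp only [ix, h1] at h; omega
    exact Prod.ext h1 (Nat.eq_of_mul_eq_mul_left (Nat.pos_of_ne_zero hk) h2)
  have hsub : ∀ z w : Fin k ×ₗ ℕ, z < w → A.HasSub (G (ix (ofLex z)) ++ G (ix (ofLex w))) := by
    intro z w h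
    refine hF _ _ ?_
    rw [hmod, hmod]
    rcases Prod.Lex.lt_iff.1 h with h | ⟨h1, h2⟩
    · exact Or.inl h
    · refine Or.inr ⟨by rw [h1], ?_⟩
      have := Nat.mul_lt_mul_of_pos_left h2 (Nat.pos_of_ne_zero hk)
      simp only [ix, h1]
      omega
  have hdom : ∀ i a, x (ix i) a ∈ B.dom := by
    intro i a
    have hs := hsub (toLex i) (toLex (i.1, i.2 + 1)) (Prod.Lex.lt_iff.2 (Or.inr ⟨rfl, by simp⟩))
    have := hH.out _ a A hA' (hs.sublist (List.sublist_append_left _ _))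
    rw [hAB] at this
    exact Str.eq_mem_diagram.1 this
  refine card_mul_le_of_strictMono
    (fun z => e ⟨x (ix (ofLex (ofLex z).2)) (rep (ofLex z).1), hdom _ _⟩) ?_
  intro z w hzw
  refine e.map_rel_iff.2 (?_ : B.Lt _ _).2.2
  rcases Prod.Lex.lt_iff.1 hzw with h | ⟨h, h'⟩
  · have hK := hrep _ _ h
    rcases lt_trichotomy (ofLex z).2 (ofLex w).2 with hlt | heq | hlt
    · exact (hH.below_of_not_before hΓ hk hK hA' hAB (hix.ne hlt.ne) (hsub _ _ hlt)).1
    · -- Here both elements come from the same piece; an element of a later piece separates them.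
      rw [heq]
      have hlt : (ofLex w).2 < toLex ((ofLex (ofLex w).2).1, (ofLex (ofLex w).2).2 + 1) :=
        Prod.Lex.lt_iff.2 (Or.inr ⟨rfl, by simp⟩)
      have hs := hsub _ _ hlt
      exact hlin.trans _ _ _ (hH.below_of_self hΓ hk hA' hAB (hix.ne hlt.ne) hs)
        (hH.below_of_not_before hΓ hk hK hA' hAB (hix.ne hlt.ne) hs).2
    · exact (hH.below_of_not_before hΓ hk hK hA' hAB (hix.ne hlt.ne) (hsub _ _ hlt)).2
  · rw [h]
    exact hH.below_of_self hΓ hk hA' hAB (hix.ne h'.ne) (hsub _ _ h')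

end

end Homogeneous

/-- Every total preorder on a finite type is given by a rank function. -/
lemma exists_rank {α : Type*} [Finite α] {K : α → α → Prop} (hrefl : ∀ a, K a a)
    (htrans : ∀ a b c, K a b → K b c → K a c) (htotal : ∀ a b, K a b ∨ K b a) :
    ∃ rk : α → ℕ, ∀ a b, K a b ↔ rk a ≤ rk b := by
  classical
  have := Fintype.ofFinite α
  let S : α → Finset α := fun a => Finset.univ.filter (K · a)
  refine ⟨fun a => (S a).card, fun a b => ⟨fun h => Finset.card_le_card fun c hc => ?_, fun h => ?_⟩⟩
  · simp only [S, Finset.mem_filter, Finset.mem_univ, true_and] at hc ⊢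
    exact htrans _ _ _ hc h
  · by_contra hab
    have hba := (htotal a b).resolve_left hab
    refine absurd h (not_le.2 (Finset.card_lt_card ?_))
    rw [Finset.ssubset_iff_of_subset fun c hc => ?_]
    · exact ⟨a, by simp [S, hrefl], by simp [S, hab]⟩
    · simp only [S, Finset.mem_filter, Finset.mem_univ, true_and] at hc ⊢
      exact htrans _ _ _ hc hba

/-! ### Inserting a piece into a shuffle of two pieces -/

lemma insertRow_self (k : ℕ) (f g : ℕ → List ℕ) : insertRow k k f g = row k f ++ row k g := by
  simp [insertRow, row]

lemma insertRow_zero (k : ℕ) (f g : ℕ → List ℕ) : insertRow k 0 f g = row k g ++ row k f := by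
  simp [insertRow, row, List.range_eq_range']

lemma row_sublist_insertRow_left {k p : ℕ} (hp : p ≤ k) (f g : ℕ → List ℕ) :
    (row k f).Sublist (insertRow k p f g) := by
  have h : row k f = (List.range p).flatMap f ++ (List.range' p (k - p)).flatMap f := by
    obtain ⟨d, rfl⟩ := Nat.exists_eq_add_of_le hp
    rw [row, ← List.flatMap_append, List.range_eq_range', List.range_eq_range',
      Nat.add_sub_cancel_left, List.range'_append_1 (s := 0) |>.symm.trans ?_]
    simp
  rw [h, insertRow]
  exact (List.sublist_append_left _ _).append_right _

lemma row_sublist_insertRow_right (k p : ℕ) (f g : ℕ → List ℕ) :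
    (row k g).Sublist (insertRow k p f g) :=
  (List.sublist_append_right _ _).trans (List.sublist_append_left _ _)

/-- A row can be inserted into the shuffle of `f` and `f'` in such a way that it lies after the
part `p` of `f` and before the part `p` of `f'`. -/
lemma exists_insert_weave {k p : ℕ} (hp : p < k) (f f' g : ℕ → List ℕ) :
    ∃ X Y, weave k f f' = X ++ Y ∧ (insertRow k (p + 1) f g).Sublist (X ++ row k g ++ Y) ∧
      (insertRow k p f' g).Sublist (X ++ row k g ++ Y) := by
  obtain ⟨d, rfl⟩ := Nat.exists_eq_add_of_lt hp
  have hd : p + d + 1 - p = d + 1 := by omega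
  have hd' : p + d + 1 - (p + 1) = d := by omega
  have hr : List.range (p + d + 1) = List.range p ++ p :: List.range' (p + 1) d := by
    rw [List.range_eq_range', List.range_eq_range', ← List.range'_succ, add_assoc,
      ← List.range'_append_1]
    simp
  have hL : ∀ l : List ℕ, (l.flatMap f).Sublist (l.flatMap fun r => f r ++ f' r) := fun l =>
    List.Sublist.flatMap_right _ fun _ _ => List.sublist_append_left _ _
  have hR : ∀ l : List ℕ, (l.flatMap f').Sublist (l.flatMap fun r => f r ++ f' r) := fun l =>
    List.Sublist.flatMap_right _ fun _ _ => List.sublist_append_right _ _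
  refine ⟨(List.range p).flatMap (fun r => f r ++ f' r) ++ f p,
    f' p ++ (List.range' (p + 1) d).flatMap (fun r => f r ++ f' r), ?_, ?_, ?_⟩
  · simp [weave, hr]
  · rw [insertRow, hd', List.range_succ, List.flatMap_append, List.flatMap_singleton]
    exact (((hL _).append_right _).append_right _).append
      ((hL _).trans (List.sublist_append_right _ _))
  · rw [insertRow, hd, List.range'_succ, List.flatMap_cons]
    exact (((hR _).trans (List.sublist_append_left _ _)).append_right _).append
      ((hR _).append_left _)

namespace PreservesOrientation

variable {Γ : Set (Finset BasicSentence × BasicSentence)} {k t : ℕ}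

/-- An orientation-preserving operator exists only if `k` divides `t`. In a homogeneous sequence of
pieces, the elements `x i a` belonging to the block `a` of the image have a class under the
preorder `K`, represented by some `b`, and a pivot: a number `p < k`, parts being counted from `0`,
such that `x i a` lies below `x j b` if the `j`-th piece is inserted right after the `p`-th part of
the `i`-th piece, but not if it is inserted right before that part. The block is determined by its
class and its pivot, so `t` is at most `k` times the number of classes, and
`Homogeneous.card_mul_le` gives the converse inequality. -/
theorem dvd (hΓ : PreservesOrientation Γ k t) (hk : k ≠ 0) : k ∣ t := by
  classical
  obtain ⟨F₀, x₀, hP₀⟩ := hΓ.exists_pieces hk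
  obtain ⟨g, hg, V₀, hV₀⟩ := exists_homogeneous
    (fun (s : Fin t × Fin t × Fin (k + 1)) i j =>
      Below Γ k (insertRow k s.2.2 (F₀ i) (F₀ j)) (x₀ i s.1) (x₀ j s.2.1))
  have hP := hP₀.comp hg
  generalize hF : (fun i => F₀ (g i)) = F at hP
  generalize hx : (fun i => x₀ (g i)) = x at hP
  obtain ⟨V, hV⟩ : ∃ V : Fin t → Fin t → ℕ → Prop, ∀ a b, ∀ p ≤ k, ∀ i j, i < j →
      (Below Γ k (insertRow k p (F i) (F j)) (x i a) (x j b) ↔ V a b p) := by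
    refine ⟨fun a b p => V₀ (a, b, Fin.ofNat (k + 1) p), fun a b p hp i j hij => ?_⟩
    have := hV₀ (a, b, Fin.ofNat (k + 1) p) i j hij
    rw [show ((Fin.ofNat (k + 1) p : Fin (k + 1)) : ℕ) = p from
      Nat.mod_eq_of_lt (Nat.lt_succ_of_le hp)] at this
    rwa [← hF, ← hx]
  clear hV₀ hF hx
  have hrow : ∀ i, (row k (F i)).Nodup := fun i =>
    (hP.nodup i (i + 1) (Nat.lt_succ_self i)).sublist (row_sublist_weave_left _ _ _)
  have hH : Homogeneous Γ k t (fun i => row k (F i)) x (V · · k) (V · · 0) :=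
    { ne_nil := hP.ne_nil
      disj := hP.disj
      nodup := hrow
      out := hP.out
      inj := hP.inj
      before := fun i j a b hij => by
        rw [← hV a b k le_rfl i j hij, insertRow_self]
      after := fun i j a b hij => by
        rw [← hV a b 0 (Nat.zero_le _) i j hij, insertRow_zero] }
  -- Two blocks of the same class and pivot coincide: insert the piece `2` into the shuffle of the
  -- pieces `0` and `1`, between their parts `p`. Then `x 0 a₂ < x 2 b < x 1 a₁`, whereas `a₁ < a₂`
  -- means that `x 1 a₁ < x 0 a₂`.
  have hpivot : ∀ a₁ a₂ b : Fin t, ∀ p < k, a₁ < a₂ → V a₂ b (p + 1) → ¬ V a₁ b p → False := by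
    intro a₁ a₂ b p hp ha h₂ h₁
    obtain ⟨X, Y, hXY, hs₀, hs₁⟩ := exists_insert_weave hp (F 0) (F 1) (F 2)
    have hnd : (X ++ row k (F 2) ++ Y).Nodup := by
      have hperm : (X ++ row k (F 2) ++ Y).Perm (row k (F 2) ++ (X ++ Y)) := by
        rw [List.append_assoc]
        exact List.perm_append_comm_assoc _ _ _
      rw [hperm.nodup_iff, ← hXY]
      refine (hrow 2).append (hP.nodup 0 1 (by omega)) fun v hv hv' => ?_
      obtain ⟨r, hr, hv'⟩ := List.mem_flatMap.1 hv'
      rcases List.mem_append.1 hv' with h | h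
      · exact hP.disj 2 0 (by omega) hv (List.mem_flatMap.2 ⟨r, hr, h⟩)
      · exact hP.disj 2 1 (by omega) hv (List.mem_flatMap.2 ⟨r, hr, h⟩)
    have hW : (weave k (F 0) (F 1)).Sublist (X ++ row k (F 2) ++ Y) := by
      rw [hXY]
      exact (List.sublist_append_left _ _).append_right _
    have e₁ : Below Γ k (X ++ row k (F 2) ++ Y) (x 0 a₂) (x 2 b) :=
      Forces.mono ((hV a₂ b (p + 1) hp 0 2 (by omega)).2 h₂) hs₀
    have e₂ : Below Γ k (X ++ row k (F 2) ++ Y) (x 2 b) (x 1 a₁) := by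
      refine Forces.mono (hΓ.below_of_not hk (hnd.sublist hs₁)
        ((hP.out 1 a₁).mono (row_sublist_insertRow_left hp.le _ _))
        ((hP.out 2 b).mono (row_sublist_insertRow_right _ _ _ _))
        (hP.inj _ _ _ _ (by omega)) fun h => h₁ ?_) hs₁
      exact (hV a₁ b p hp.le 1 2 (by omega)).1 h
    have e₃ : Below Γ k (X ++ row k (F 2) ++ Y) (x 1 a₁) (x 0 a₂) :=
      Forces.mono (hP.below 0 1 a₁ a₂ (by omega) ha) hW
    exact hΓ.below_asymm hk hnd (hΓ.below_trans e₁ e₂) e₃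
  obtain ⟨rk, hrk⟩ := exists_rank (K := (V · · k)) (hH.before_self hΓ hk)
    (fun _ _ _ => hH.before_trans hΓ hk) (hH.before_total hΓ hk)
  let S : Finset ℕ := Finset.univ.image rk
  have hrep : ∀ l : S, ∃ b, rk b = l := fun l => by
    obtain ⟨b, -, hb⟩ := Finset.mem_image.1 l.2
    exact ⟨b, hb⟩
  choose rep hrep using hrep
  have hlower : Fintype.card S * k ≤ t := by
    refine hH.card_mul_le hΓ hk rep fun m m' h h' => ?_
    rw [hrk, hrep, hrep] at h'
    exact absurd h (not_lt.2 h')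
  let cl : Fin t → S := fun a => ⟨rk a, Finset.mem_image_of_mem _ (Finset.mem_univ a)⟩
  -- Inserting a piece at the very beginning and at the very end has different results.
  have hpiv : ∀ a, ∃ p : Fin k, V a (rep (cl a)) (p + 1) ∧ ¬ V a (rep (cl a)) p := by
    intro a
    by_contra hcon
    push Not at hcon
    have hall : ∀ d p, p + d = k → V a (rep (cl a)) p := by
      intro d
      induction d with
      | zero =>
        rintro p rfl
        exact (hrk _ _).2 (hrep (cl a)).ge
      | succ d ih =>
        intro p hp
        exact hcon ⟨p, by omega⟩ (ih (p + 1) (by omega))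
    exact hH.not_after_of_before hΓ hk ((hrk _ _).2 (hrep (cl a)).le) (hall k 0 (by omega))
  choose piv hpiv₁ hpiv₂ using hpiv
  have hinj : Function.Injective fun a => (cl a, piv a) := by
    intro a a' h
    obtain ⟨h1, h2⟩ := Prod.mk.inj h
    by_contra hne
    rcases lt_or_gt_of_ne hne with hlt | hlt
    · refine hpivot a a' (rep (cl a)) (piv a) (piv a).2 hlt ?_ (hpiv₂ a)
      rw [h1, h2]; exact hpiv₁ a'
    · refine hpivot a' a (rep (cl a')) (piv a') (piv a').2 hlt ?_ (hpiv₂ a')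
      rw [← h1, ← h2]; exact hpiv₁ a
  have hupper : t ≤ Fintype.card S * k := by
    have := Fintype.card_le_of_injective _ hinj
    rwa [Fintype.card_prod, Fintype.card_fin, Fintype.card_fin] at this
  exact Dvd.intro_left _ (le_antisymm hlower hupper)

end PreservesOrientation

/-! ### Orientation -/

/-- The basic sentence that expresses the same for the reversed order. -/
def BasicSentence.swap : BasicSentence → BasicSentence
  | .eq a b => .eq a b
  | .ne a b => .ne a b
  | .lt a b => .lt b a
  | .nlt a b => .nlt b a

lemma Str.swap_mem_diagram {A : Str} {φ : BasicSentence} :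
    φ.swap ∈ A.diagram ↔ φ ∈ A.rev.diagram := by
  rcases φ with ⟨a, b⟩ | ⟨a, b⟩ | ⟨a, b⟩ | ⟨a, b⟩
  · exact Iff.rfl
  · exact Iff.rfl
  · exact ⟨fun ⟨h1, h2, h⟩ => ⟨h2, h1, h⟩, fun ⟨h1, h2, h⟩ => ⟨h2, h1, h⟩⟩
  · exact ⟨fun ⟨h1, h2, h⟩ => ⟨h2, h1, h⟩, fun ⟨h1, h2, h⟩ => ⟨h2, h1, h⟩⟩

lemma iso_of_copies {X : Type} [LT X] {A B : Str} (hA : A ∈ copies X) (hB : B ∈ copies X) :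
    A.Iso B := by
  obtain ⟨e⟩ := hA
  obtain ⟨f⟩ := hB
  exact ⟨e.trans f.symm⟩

lemma copies_of_iso {X : Type} [LT X] {A B : Str} (hA : A ∈ copies X) (h : A.Iso B) :
    B ∈ copies X := by
  obtain ⟨e⟩ := hA
  obtain ⟨f⟩ := h
  exact ⟨f.symm.trans e⟩

lemma not_iso_of_copies {k : ℕ} (hk : k ≠ 0) {A B : Str} (hA : A ∈ copies (Fin k ×ₗ ℕ))
    (hB : B ∈ copies (Fin k ×ₗ ℕᵒᵈ)) : ¬ A.Iso B := by
  intro h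
  have hA' := copies_of_iso hA h
  obtain ⟨e⟩ := hB
  let z : ℕ → Fin k ×ₗ ℕᵒᵈ := fun n => toLex (⟨0, Nat.pos_of_ne_zero hk⟩, OrderDual.toDual n)
  refine Str.not_descending hA' (fun n => e.symm (z n)) fun i j hij => ?_
  exact ⟨(e.symm (z j)).2, (e.symm (z i)).2,
    e.symm.map_rel_iff.2 (Prod.Lex.lt_iff.2 (Or.inr ⟨rfl, hij⟩))⟩

/-- A computable embedding respects orientation or reverses it; in the latter case one passes to the
reversed images. -/
lemma exists_preservesOrientation {k t : ℕ} (hk : k ≠ 0) {Γ}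
    (h : IsComputableEmbedding Γ (omegaPair k) (omegaPair t)) :
    ∃ Γ', PreservesOrientation Γ' k t := by
  have hA₀ := extStr_mem hk [] 0
  have hD₀ := rev_mem_copies_dual hA₀
  set A₀ := extStr k [] 0
  obtain ⟨B₀, hB₀, hAB⟩ := h.maps A₀ (Or.inl hA₀)
  obtain ⟨E₀, hE₀, hDE⟩ := h.maps A₀.rev (Or.inr hD₀)
  have hne : ¬ B₀.Iso E₀ := fun hi => not_iso_of_copies hk hA₀ hD₀
    ((h.iso_iff _ (Or.inl hA₀) _ (Or.inr hD₀) _ _ hAB hDE).2 hi)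
  have hω : ∀ A ∈ copies (Fin k ×ₗ ℕ), ∃ B, B₀.Iso B ∧ applyOp Γ A.diagram = B.diagram := by
    intro A hA
    obtain ⟨B, -, hB⟩ := h.maps A (Or.inl hA)
    exact ⟨B, (h.iso_iff _ (Or.inl hA₀) _ (Or.inl hA) _ _ hAB hB).1 (iso_of_copies hA₀ hA), hB⟩
  have hd : ∀ A ∈ copies (Fin k ×ₗ ℕᵒᵈ), ∃ B, E₀.Iso B ∧ applyOp Γ A.diagram = B.diagram := by
    intro A hA
    obtain ⟨B, -, hB⟩ := h.maps A (Or.inr hA)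
    exact ⟨B, (h.iso_iff _ (Or.inr hD₀) _ (Or.inr hA) _ _ hDE hB).1 (iso_of_copies hD₀ hA), hB⟩
  have hrev : ∀ S (B : Str), applyOp Γ S = B.diagram →
      applyOp {q | (q.1, q.2.swap) ∈ Γ} S = B.rev.diagram := by
    intro S B hB
    ext φ
    rw [← Str.swap_mem_diagram, ← hB]
    rfl
  rcases hB₀ with hB₀ | hB₀ <;> rcases hE₀ with hE₀ | hE₀
  · exact absurd (iso_of_copies hB₀ hE₀) hne
  · refine ⟨Γ, fun A hA => ?_, fun A hA => ?_⟩
    · obtain ⟨B, hi, hB⟩ := hω A hA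
      exact ⟨B, copies_of_iso hB₀ hi, hB⟩
    · obtain ⟨B, hi, hB⟩ := hd A hA
      exact ⟨B, copies_of_iso hE₀ hi, hB⟩
  · refine ⟨{q | (q.1, q.2.swap) ∈ Γ}, fun A hA => ?_, fun A hA => ?_⟩
    · obtain ⟨B, hi, hB⟩ := hω A hA
      exact ⟨B.rev, rev_mem_copies (copies_of_iso hB₀ hi), hrev _ _ hB⟩
    · obtain ⟨B, hi, hB⟩ := hd A hA
      exact ⟨B.rev, rev_mem_copies_dual (copies_of_iso hE₀ hi), hrev _ _ hB⟩
  · exact absurd (iso_of_copies hB₀ hE₀) hne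

/-! ### Multiplying a structure -/

/-- The sum of `m` copies of `A`; the name `u` denotes the element `u / m` of the copy `u % m`. -/
def mulStr (m : ℕ) (A : Str) : Str :=
  ⟨{u | u / m ∈ A.dom}, fun u v => u.1 % m < v.1 % m ∨ u.1 % m = v.1 % m ∧ A.Lt (u.1 / m) (v.1 / m)⟩

lemma mulStr_mem_copies {m k : ℕ} (hm : m ≠ 0) {Y : Type} [LinearOrder Y] {A : Str}
    (hA : A ∈ copies (Fin k ×ₗ Y)) : mulStr m A ∈ copies (Fin (m * k) ×ₗ Y) := by
  obtain ⟨e⟩ := hA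
  have hm' := Nat.pos_of_ne_zero hm
  let f : (mulStr m A).dom ≃ Fin m × A.dom :=
    { toFun := fun u => (⟨u.1 % m, Nat.mod_lt _ hm'⟩, ⟨u.1 / m, u.2⟩)
      invFun := fun z => ⟨z.1 + m * z.2, by
        change (z.1 + m * z.2 : ℕ) / m ∈ A.dom
        rw [Nat.add_mul_div_left _ _ hm', Nat.div_eq_of_lt z.1.2, Nat.zero_add]
        exact z.2.2⟩
      left_inv := fun u => Subtype.ext (Nat.mod_add_div u.1 m)
      right_inv := fun z => by
        refine Prod.ext (Fin.ext ?_) (Subtype.ext ?_)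
        · simp [Nat.mod_eq_of_lt z.1.2]
        · simp [Nat.add_mul_div_left _ _ hm', Nat.div_eq_of_lt z.1.2] }
  let g : (mulStr m A).dom ≃ Fin (m * k) ×ₗ Y :=
    ((f.trans ((Equiv.refl _).prodCongr (e.toEquiv.trans ofLex))).trans
      ((Equiv.prodAssoc _ _ _).symm.trans (finProdFinEquiv.prodCongr (Equiv.refl _)))).trans toLex
  refine ⟨⟨g, ?_⟩⟩
  intro u v
  have hlt : A.Lt (u.1 / m) (v.1 / m) ↔ e ⟨u.1 / m, u.2⟩ < e ⟨v.1 / m, v.2⟩ :=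
    ⟨fun h => e.map_rel_iff.2 h.2.2, fun h => ⟨u.2, v.2, e.map_rel_iff.1 h⟩⟩
  change g u < g v ↔ (u.1 % m < v.1 % m ∨ u.1 % m = v.1 % m ∧ A.Lt (u.1 / m) (v.1 / m))
  rw [hlt, Prod.Lex.lt_iff, Prod.Lex.lt_iff]
  have h1 : ∀ w : (mulStr m A).dom, ((ofLex (g w)).1 : ℕ) =
      (ofLex (e ⟨w.1 / m, w.2⟩)).1 + k * (w.1 % m) := fun w => rfl
  have h2 : ∀ w : (mulStr m A).dom, (ofLex (g w)).2 = (ofLex (e ⟨w.1 / m, w.2⟩)).2 := fun w => rfl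
  rw [h2, h2, Fin.lt_def, Fin.ext_iff, h1, h1, Fin.lt_def, Fin.ext_iff]
  have hu := (ofLex (e ⟨u.1 / m, u.2⟩)).1.2
  have hv := (ofLex (e ⟨v.1 / m, v.2⟩)).1.2
  generalize ((ofLex (e ⟨u.1 / m, u.2⟩)).1 : ℕ) = r at *
  generalize ((ofLex (e ⟨v.1 / m, v.2⟩)).1 : ℕ) = s at *
  rcases lt_trichotomy (u.1 % m) (v.1 % m) with h | h | h
  · have : k * (u.1 % m + 1) ≤ k * (v.1 % m) := Nat.mul_le_mul_left _ h
    rw [Nat.mul_add] at this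
    exact iff_of_true (Or.inl (by omega)) (Or.inl h)
  · simp [h]
  · have : k * (v.1 % m + 1) ≤ k * (u.1 % m) := Nat.mul_le_mul_left _ h
    rw [Nat.mul_add] at this
    refine iff_of_false ?_ ?_ <;> rintro (h' | ⟨h', -⟩) <;> omega

/-- A basic sentence saying that `a` and `b` belong to the domain. -/
def BasicSentence.mem (a b : ℕ) : BasicSentence := if a = b then .eq a b else .ne a b

/-- A basic sentence that is false in every structure. -/
def BasicSentence.absurd : BasicSentence := .ne 0 0

/-- The basic sentence that expresses in `A` that the given sentence holds in `mulStr m A`. -/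
def BasicSentence.pull (m : ℕ) : BasicSentence → BasicSentence
  | .eq a b => if a = b then .mem (a / m) (b / m) else .absurd
  | .ne a b => if a = b then .absurd else .mem (a / m) (b / m)
  | .lt a b => if a % m < b % m then .mem (a / m) (b / m) else
      if a % m = b % m then .lt (a / m) (b / m) else .absurd
  | .nlt a b => if a % m < b % m then .absurd else
      if a % m = b % m then .nlt (a / m) (b / m) else .mem (a / m) (b / m)

lemma Str.mem_mem_diagram {A : Str} {a b : ℕ} :
    BasicSentence.mem a b ∈ A.diagram ↔ a ∈ A.dom ∧ b ∈ A.dom := by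
  by_cases h : a = b <;> simp [BasicSentence.mem, Str.diagram, Str.Holds, h]

lemma Str.absurd_mem_diagram {A : Str} : ¬ BasicSentence.absurd ∈ A.diagram :=
  fun h => h.2.2 rfl

lemma pull_mem_diagram {m : ℕ} {A : Str} (φ : BasicSentence) :
    φ.pull m ∈ A.diagram ↔ φ ∈ (mulStr m A).diagram := by
  rcases φ with ⟨a, b⟩ | ⟨a, b⟩ | ⟨a, b⟩ | ⟨a, b⟩
  · change _ ↔ a / m ∈ A.dom ∧ b / m ∈ A.dom ∧ a = b
    by_cases h : a = b <;>
      simp [BasicSentence.pull, h, Str.mem_mem_diagram, Str.absurd_mem_diagram]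
  · change _ ↔ a / m ∈ A.dom ∧ b / m ∈ A.dom ∧ a ≠ b
    by_cases h : a = b <;>
      simp [BasicSentence.pull, h, Str.mem_mem_diagram, Str.absurd_mem_diagram]
  · change _ ↔ ∃ (_ : a / m ∈ A.dom) (_ : b / m ∈ A.dom),
      (a % m < b % m ∨ a % m = b % m ∧ A.Lt (a / m) (b / m))
    rcases lt_trichotomy (a % m) (b % m) with h | h | h
    · simp [BasicSentence.pull, h, Str.mem_mem_diagram]
    · simp only [BasicSentence.pull, h, lt_irrefl, if_false, if_true, false_or, true_and]
      exact ⟨fun h => ⟨h.1, h.2.1, h⟩, fun ⟨_, _, h⟩ => h⟩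
    · simp [BasicSentence.pull, h.not_gt, h.ne', Str.absurd_mem_diagram]
  · change _ ↔ ∃ (_ : a / m ∈ A.dom) (_ : b / m ∈ A.dom),
      ¬ (a % m < b % m ∨ a % m = b % m ∧ A.Lt (a / m) (b / m))
    rcases lt_trichotomy (a % m) (b % m) with h | h | h
    · simp [BasicSentence.pull, h, Str.absurd_mem_diagram]
    · simp only [BasicSentence.pull, h, lt_irrefl, if_false, if_true, false_or, true_and]
      exact ⟨fun ⟨h1, h2, h⟩ => ⟨h1, h2, fun h' => h h'.2.2⟩,
        fun ⟨h1, h2, h⟩ => ⟨h1, h2, fun h' => h ⟨h1, h2, h'⟩⟩⟩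
    · simp [BasicSentence.pull, h.not_gt, h.ne', Str.mem_mem_diagram]

section Primrec

variable {α : Type*} [Primcodable α] {f g : α → ℕ}

lemma primrec_equivSum_symm :
    Primrec (BasicSentence.equivSum.symm : _ → BasicSentence) := Primrec.of_equiv_symm

lemma primrec_eq (hf : Primrec f) (hg : Primrec g) : Primrec fun x => BasicSentence.eq (f x) (g x) :=
  primrec_equivSum_symm.comp (Primrec.sumInl.comp (Primrec.sumInl.comp (hf.pair hg)))

lemma primrec_ne (hf : Primrec f) (hg : Primrec g) : Primrec fun x => BasicSentence.ne (f x) (g x) :=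
  primrec_equivSum_symm.comp (Primrec.sumInl.comp (Primrec.sumInr.comp (hf.pair hg)))

lemma primrec_lt (hf : Primrec f) (hg : Primrec g) : Primrec fun x => BasicSentence.lt (f x) (g x) :=
  primrec_equivSum_symm.comp (Primrec.sumInr.comp (Primrec.sumInl.comp (hf.pair hg)))

lemma primrec_nlt (hf : Primrec f) (hg : Primrec g) :
    Primrec fun x => BasicSentence.nlt (f x) (g x) :=
  primrec_equivSum_symm.comp (Primrec.sumInr.comp (Primrec.sumInr.comp (hf.pair hg)))

lemma primrec_mem (hf : Primrec f) (hg : Primrec g) :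
    Primrec fun x => BasicSentence.mem (f x) (g x) :=
  Primrec.ite (Primrec.eq.comp hf hg) (primrec_eq hf hg) (primrec_ne hf hg)

lemma primrec_pull (m : ℕ) : Primrec (BasicSentence.pull m) := by
  have ha : Primrec fun x : BasicSentence × (ℕ × ℕ) => x.2.1 := Primrec.fst.comp Primrec.snd
  have hb : Primrec fun x : BasicSentence × (ℕ × ℕ) => x.2.2 := Primrec.snd.comp Primrec.snd
  have hda : Primrec fun x : BasicSentence × (ℕ × ℕ) => x.2.1 / m :=
    Primrec.nat_div.comp ha (Primrec.const m)
  have hdb : Primrec fun x : BasicSentence × (ℕ × ℕ) => x.2.2 / m :=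
    Primrec.nat_div.comp hb (Primrec.const m)
  have hma : Primrec fun x : BasicSentence × (ℕ × ℕ) => x.2.1 % m :=
    Primrec.nat_mod.comp ha (Primrec.const m)
  have hmb : Primrec fun x : BasicSentence × (ℕ × ℕ) => x.2.2 % m :=
    Primrec.nat_mod.comp hb (Primrec.const m)
  have hc : Primrec fun _ : BasicSentence × (ℕ × ℕ) => BasicSentence.absurd := Primrec.const _
  have h1 : Primrec₂ fun (_ : BasicSentence) (p : ℕ × ℕ) => (BasicSentence.eq p.1 p.2).pull m :=
    Primrec.ite (Primrec.eq.comp ha hb) (primrec_mem hda hdb) hc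
  have h2 : Primrec₂ fun (_ : BasicSentence) (p : ℕ × ℕ) => (BasicSentence.ne p.1 p.2).pull m :=
    Primrec.ite (Primrec.eq.comp ha hb) hc (primrec_mem hda hdb)
  have h3 : Primrec₂ fun (_ : BasicSentence) (p : ℕ × ℕ) => (BasicSentence.lt p.1 p.2).pull m :=
    Primrec.ite (Primrec.nat_lt.comp hma hmb) (primrec_mem hda hdb)
      (Primrec.ite (Primrec.eq.comp hma hmb) (primrec_lt hda hdb) hc)
  have h4 : Primrec₂ fun (_ : BasicSentence) (p : ℕ × ℕ) => (BasicSentence.nlt p.1 p.2).pull m :=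
    Primrec.ite (Primrec.nat_lt.comp hma hmb) hc
      (Primrec.ite (Primrec.eq.comp hma hmb) (primrec_nlt hda hdb) (primrec_mem hda hdb))
  have he : Primrec BasicSentence.equivSum := Primrec.of_equiv
  have h12 : Primrec₂ fun (_ : BasicSentence) (q : (ℕ × ℕ) ⊕ (ℕ × ℕ)) =>
      (Sum.casesOn q (fun p => (BasicSentence.eq p.1 p.2).pull m)
        (fun p => (BasicSentence.ne p.1 p.2).pull m) : BasicSentence) :=
    Primrec.sumCasesOn Primrec.snd (h1.comp₂ (Primrec.fst.comp₂ Primrec₂.left) Primrec₂.right)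
      (h2.comp₂ (Primrec.fst.comp₂ Primrec₂.left) Primrec₂.right)
  have h34 : Primrec₂ fun (_ : BasicSentence) (q : (ℕ × ℕ) ⊕ (ℕ × ℕ)) =>
      (Sum.casesOn q (fun p => (BasicSentence.lt p.1 p.2).pull m)
        (fun p => (BasicSentence.nlt p.1 p.2).pull m) : BasicSentence) :=
    Primrec.sumCasesOn Primrec.snd (h3.comp₂ (Primrec.fst.comp₂ Primrec₂.left) Primrec₂.right)
      (h4.comp₂ (Primrec.fst.comp₂ Primrec₂.left) Primrec₂.right)
  exact (Primrec.sumCasesOn he h12 h34).of_eq fun φ => by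
    rcases φ with _ | _ | _ | _ <;> rfl

end Primrec

lemma iso_of_diagram_eq {A B : Str} (h : A.diagram = B.diagram) : A.Iso B := by
  have hdom : ∀ a, a ∈ A.dom ↔ a ∈ B.dom := fun a => by
    rw [← Str.eq_mem_diagram, h, Str.eq_mem_diagram]
  refine ⟨⟨Equiv.subtypeEquivRight hdom, ?_⟩⟩
  rintro ⟨a, ha⟩ ⟨b, hb⟩
  have hlt : A.Lt a b ↔ B.Lt a b := by rw [← Str.lt_mem_diagram, h, Str.lt_mem_diagram]
  exact ⟨fun h' => (hlt.2 ⟨_, _, h'⟩).2.2, fun h' => (hlt.1 ⟨_, _, h'⟩).2.2⟩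

/-- The operator `A ↦ mulStr m A` is a computable embedding. -/
lemma computablyEmbeddable_mul {k m : ℕ} (hk : k ≠ 0) (hm : m ≠ 0) :
    ComputablyEmbeddable (omegaPair k) (omegaPair (m * k)) := by
  have happ : ∀ A : Str, applyOp {q | q.2.pull m ∈ q.1} A.diagram = (mulStr m A).diagram := by
    intro A
    ext φ
    rw [← pull_mem_diagram]
    refine ⟨fun ⟨α, h1, h2⟩ => h2 _ h1, fun h => ⟨{φ.pull m}, Finset.mem_singleton_self _, ?_⟩⟩
    intro ψ hψ
    rwa [Finset.mem_singleton.1 hψ]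
  have hmk : m * k ≠ 0 := Nat.mul_ne_zero hm hk
  refine ⟨{q | q.2.pull m ∈ q.1}, ?_, ?_, ?_⟩
  · have h : PrimrecPred fun p : List BasicSentence × BasicSentence => ∃ a ∈ p.1, a = p.2.pull m :=
      Primrec.eq.exists_mem_list.comp Primrec.fst ((primrec_pull m).comp Primrec.snd)
    refine (h.of_eq fun p => ?_).computablePred.to_re
    simp
  · rintro A (hA | hA)
    · exact ⟨_, Or.inl (mulStr_mem_copies hm hA), happ A⟩
    · exact ⟨_, Or.inr (mulStr_mem_copies hm hA), happ A⟩
  · intro A hA B hB A' B' hA' hB'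
    have hA' := iso_of_diagram_eq ((happ A).symm.trans hA')
    have hB' := iso_of_diagram_eq ((happ B).symm.trans hB')
    have hsymm : ∀ {A B : Str}, A.Iso B → B.Iso A := fun ⟨e⟩ => ⟨e.symm⟩
    rcases hA with hA | hA <;> rcases hB with hB | hB <;>
      have hA'' := copies_of_iso (mulStr_mem_copies hm hA) hA' <;>
      have hB'' := copies_of_iso (mulStr_mem_copies hm hB) hB'
    · exact iff_of_true (iso_of_copies hA hB) (iso_of_copies hA'' hB'')
    · exact iff_of_false (not_iso_of_copies hk hA hB) (not_iso_of_copies hmk hA'' hB'')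
    · exact iff_of_false (fun h => not_iso_of_copies hk hB hA (hsymm h))
        fun h => not_iso_of_copies hmk hB'' hA'' (hsymm h)
    · exact iff_of_true (iso_of_copies hA hB) (iso_of_copies hA'' hB'')

end LinOrdEmb

theorem mainTheorem1 (k t : ℕ) (hk : k ≠ 0) (ht : t ≠ 0) :
    k ∣ t ↔ LinOrdEmb.ComputablyEmbeddable (LinOrdEmb.omegaPair k) (LinOrdEmb.omegaPair t) := by
  constructor
  · rintro ⟨m, rfl⟩
    rw [mul_comm]
    exact LinOrdEmb.computablyEmbeddable_mul hk (right_ne_zero_of_mul ht)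
  · rintro ⟨Γ, hΓ⟩
    obtain ⟨Γ', hΓ'⟩ := LinOrdEmb.exists_preservesOrientation hk hΓ
    exact hΓ'.dvd hk
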